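/- **Setting.** Consider $\kappa$ subcontrollers and, for $n\ge 0$, the networked linear system $$x_{n+1}=Ax_n+\sum_{i=1}^{\kappa}B_iu_{i,n}+w_n,\qquad y_{i,n}=C_ix_n+z_{i,n}+v_{i,n},\qquad s_{i,j,n}=y_{j,n}+\nu_{i,j,n},$$ with $x_n\in\mathbb R^p$, $u_{i,n}\in\mathbb R^{q_i}$, $y_{i,n}\in\mathbb R^{m_i}$, where $v_{i,n}$ is a sensor attack, $\nu_{i,j,n}$ is a communication attack and $s_{i,j,n}$ is the measurement of subcontroller $j$ received by subcontroller $i$. Subcontroller $i$ applies $u_{i,n}=K_i\hat x_{i,n}+e_{i,n}$ with a private excitation $e_{i,n}$ and runs the observer $$\hat x_{i,n+1}=(A+BK+LC)\hat x_{i,n}-\sum_{j}L_js_{i,j,n}+B_ie_{i,n},\qquad BK=\sum_jB_jK_j,\quad LC=\sum_jL_jC_j .$$ The processes $w_n$, $z_{i,n}$, $e_{i,n}$ ($n\ge 0$) are i.i.d. in $n$, Gaussian with mean zero and covariances $\Sigma_W$, $\Sigma_{Z,i}$, $\Sigma_{E,i}$; they are mutually independent, and independent of the (possibly random) integrable initial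 condition $(x_0,\hat x_{1,0},\dots,\hat x_{\kappa,0})$. Assume that $A+BK$, $A+LC$ and $A+BK+LC$ are Schur stable (all eigenvalues of modulus $<1$). **Definitions.** Let $\delta_{i,n}=\hat x_{i,n}-x_n$ and let $\Delta_n\in\mathbb R^{\kappa p}$ be the stacked vector of $\delta_{1,n},\dots,\delta_{\kappa,n}$. Let $f_i\in\mathbb R^\kappa$ be the $i$-th unit vector, $\mathbf 1\in\mathbb R^\kappa$ the all-ones vector, $G_i=f_i\otimes B_i-\mathbf 1\otimes B_i$, and let $\underline A$ be the matrix of the linear map with $i$-th component $(\underline A\Delta)_i=(A+BK+LC)\delta_i-\sum_lB_lK_l\delta_l$. Let $\Sigma_\Delta$ be the positive semidefinite solution of the Lyapunov equation $$\Sigma_\Delta=\underline A\Sigma_\Delta\underline A^{\mathsf T}+\sum_{i}G_i\Sigma_{E,i}G_i^{\mathsf T}+\mathbf 1\mathbf 1^{\mathsf T}\otimes\Big(\Sigma_W+\sum_jL_j\Sigma_{Z,j}L_j^{\mathsf T}\Big),$$ and let $D_i$ be its $i$-th diagonal $p\times p$ block. Let $\Sigma_{\Delta,i,k}=\underline A^kG_i\Sigma_{E,i}$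 and let $Q_{i,k}\in\mathbb R^{p\times q_i}$ be its $i$-th block of $p$ rows. Whenever it exists, let $k'_{i,j}=\min\{k\ge 0: C_j(A+BK)^kB_i\ne 0\}$, and set $$\psi_{n,i,j}=\begin{bmatrix}e_{i,n-k'_{i,j}-1}\\ C_j\hat x_{i,n}-s_{i,j,n}\end{bmatrix},\qquad\text{with } e_{i,t}=0\text{ for }t<0 .$$ **Theorem.** If $v_{i,n}\equiv 0$ and $\nu_{i,j,n}\equiv 0$, then $\Sigma_\Delta$ exists and is unique, $\mathbb E(\Delta_ne_{i,n-k-1}^{\mathsf T})=\Sigma_{\Delta,i,k}$ for all $i$, all $k\ge 0$ and all $n\ge k+1$, and for all $i,j$ for which $k'_{i,j}$ exists, almost surely $$\lim_{N\to\infty}\frac1N\sum_{n=0}^{N-1}\psi_{n,i,j}\psi_{n,i,j}^{\mathsf T}=R_{i,j}:=\begin{bmatrix}\Sigma_{E,i}&Q_{i,k'_{i,j}}^{\mathsf T}C_j^{\mathsf T}\\ C_jQ_{i,k'_{i,j}}&C_jD_iC_j^{\mathsf T}+\Sigma_{Z,j}\end{bmatrix}.$$ Moreover every $\psi_{n,i,j}$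 is integrable and $\lim_{n\to\infty}\mathbb E(\psi_{n,i,j})=0$. -/

import Mathlib

open MeasureTheory ProbabilityTheory Filter Topology Matrix
open scoped Kronecker

namespace NetLTI

/-- A real square matrix is Schur stable if all its complex eigenvalues have modulus `< 1`. -/
def SchurStable {n : Type*} [Fintype n] [DecidableEq n] (M : Matrix n n ℝ) : Prop :=
  ∀ c ∈ spectrum ℂ (M.map (algebraMap ℝ ℂ)), ‖c‖ < 1

/-- The data of a networked LTI system with `κ` subcontrollers, state dimension `p`,
measurement dimensions `m i`, input dimensions `q i`: system matrices, gains, and the covariances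
of the process noise, of the measurement noises and of the private excitations. -/
structure Plant (κ p : ℕ) (m q : Fin κ → ℕ) where
  A : Matrix (Fin p) (Fin p) ℝ
  B : ∀ i, Matrix (Fin p) (Fin (q i)) ℝ
  C : ∀ i, Matrix (Fin (m i)) (Fin p) ℝ
  K : ∀ i, Matrix (Fin (q i)) (Fin p) ℝ
  L : ∀ i, Matrix (Fin p) (Fin (m i)) ℝ
  covW : Matrix (Fin p) (Fin p) ℝ
  covZ : ∀ i, Matrix (Fin (m i)) (Fin (m i)) ℝ
  covE : ∀ i, Matrix (Fin (q i)) (Fin (q i)) ℝ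

/-- One realization of all exogenous quantities: initial state, initial observer states, process
noise, measurement noises, private excitations, sensor attacks `v i n` and communication attacks
`ν i j n` (on the measurement of `j` sent to `i`). -/
structure Signals (κ p : ℕ) (m q : Fin κ → ℕ) where
  x0 : Fin p → ℝ
  xhat0 : Fin κ → Fin p → ℝ
  w : ℕ → Fin p → ℝ
  z : ∀ i, ℕ → Fin (m i) → ℝ
  e : ∀ i, ℕ → Fin (q i) → ℝ
  v : ∀ i, ℕ → Fin (m i) → ℝ
  ν : ∀ (_ : Fin κ) (j : Fin κ), ℕ → Fin (m j) → ℝ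

variable {κ p : ℕ} {m q : Fin κ → ℕ}

namespace Plant

/-- `B K = ∑ i, B_i K_i`. -/
def BK (P : Plant κ p m q) : Matrix (Fin p) (Fin p) ℝ := ∑ i, P.B i * P.K i

/-- `L C = ∑ i, L_i C_i`. -/
def LC (P : Plant κ p m q) : Matrix (Fin p) (Fin p) ℝ := ∑ i, P.L i * P.C i

/-- The measurement `y_i = C_i x + z_i + v_i` at time `n`, when the state is `x`. -/
def meas (P : Plant κ p m q) (S : Signals κ p m q) (x : Fin p → ℝ) (i : Fin κ) (n : ℕ) :
    Fin (m i) → ℝ :=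
  P.C i *ᵥ x + S.z i n + S.v i n

/-- The value `s_{i,j} = y_j + ν_{i,j}` received by `i` from `j` at time `n`, when the state
is `x`. -/
def recv (P : Plant κ p m q) (S : Signals κ p m q) (x : Fin p → ℝ) (i j : Fin κ) (n : ℕ) :
    Fin (m j) → ℝ :=
  P.meas S x j n + S.ν i j n

/-- The closed loop: the pair (system state, observer states of all subcontrollers) at each time,
under the inputs `u_i = K_i x̂_i + e_i`. -/
def state (P : Plant κ p m q) (S : Signals κ p m q) :
    ℕ → (Fin p → ℝ) × (Fin κ → Fin p → ℝ)
  | 0 => (S.x0, S.xhat0)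
  | n + 1 =>
    let x := (P.state S n).1
    let xhat := (P.state S n).2
    (P.A *ᵥ x + ∑ i, P.B i *ᵥ (P.K i *ᵥ xhat i + S.e i n) + S.w n,
     fun i => (P.A + P.BK + P.LC) *ᵥ xhat i - ∑ j, P.L j *ᵥ P.recv S x i j n
       + P.B i *ᵥ S.e i n)

/-- The system state `x_n`. -/
def x (P : Plant κ p m q) (S : Signals κ p m q) (n : ℕ) : Fin p → ℝ := (P.state S n).1

/-- The observer state `x̂_{i,n}`. -/
def xhat (P : Plant κ p m q) (S : Signals κ p m q) (i : Fin κ) (n : ℕ) : Fin p → ℝ :=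
  (P.state S n).2 i

/-- The communicated value `s_{i,j,n}`. -/
def s (P : Plant κ p m q) (S : Signals κ p m q) (i j : Fin κ) (n : ℕ) : Fin (m j) → ℝ :=
  P.recv S (P.x S n) i j n

/-- The stacked observer errors `Δ_n = (δ_{1,n}, …, δ_{κ,n})`, `δ_{i,n} = x̂_{i,n} - x_n`. -/
def Delta (P : Plant κ p m q) (S : Signals κ p m q) (n : ℕ) : Fin κ × Fin p → ℝ :=
  fun a => P.xhat S a.1 n a.2 - P.x S n a.2

/-- `ψ_{n,i,j}` formed with the lag `k`: the excitation `e_{i,n-k-1}` (zero at negative times)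
stacked on the residual `C_j x̂_{i,n} - s_{i,j,n}`. -/
def psi (P : Plant κ p m q) (S : Signals κ p m q) (i j : Fin κ) (k n : ℕ) :
    Fin (q i) ⊕ Fin (m j) → ℝ :=
  Sum.elim (if k + 1 ≤ n then S.e i (n - (k + 1)) else 0)
    (P.C j *ᵥ P.xhat S i n - P.s S i j n)

/-- The matrix of the attack-free error dynamics
`δ_i ↦ (A + BK + LC) δ_i - ∑ l, B_l K_l δ_l`. -/
def errA (P : Plant κ p m q) : Matrix (Fin κ × Fin p) (Fin κ × Fin p) ℝ :=
  (1 : Matrix (Fin κ) (Fin κ) ℝ) ⊗ₖ (P.A + P.BK + P.LC)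
    - Matrix.of fun a b => (P.B b.1 * P.K b.1) a.2 b.2

/-- The matrix `f_i ⊗ B_i - (1, …, 1)ᵀ ⊗ B_i` through which `e_i` enters the error dynamics. -/
def errB (P : Plant κ p m q) (i : Fin κ) : Matrix (Fin κ × Fin p) (Fin (q i)) ℝ :=
  Matrix.of fun a b => (if a.1 = i then P.B i a.2 b else 0) - P.B i a.2 b

/-- The covariance of the total noise that drives the error dynamics, that is, of
`blkdiag(B_1, …, B_κ) E_n - (1, …, 1)ᵀ ⊗ (w_n + ∑ j, (L_j z_{j,n} + B_j e_{j,n}))`. -/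
def errCov (P : Plant κ p m q) : Matrix (Fin κ × Fin p) (Fin κ × Fin p) ℝ :=
  ∑ i, P.errB i * P.covE i * (P.errB i)ᵀ
    + (Matrix.of fun _ _ => (1 : ℝ) : Matrix (Fin κ) (Fin κ) ℝ) ⊗ₖ
        (P.covW + ∑ j, P.L j * P.covZ j * (P.L j)ᵀ)

/-- `T` is a positive semidefinite solution of the Lyapunov equation of the error dynamics. -/
def IsErrLyapunov (P : Plant κ p m q) (T : Matrix (Fin κ × Fin p) (Fin κ × Fin p) ℝ) : Prop :=
  T.PosSemidef ∧ T = P.errA * T * P.errAᵀ + P.errCov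

/-- `Σ_{Δ,i,k} = 𝐀^k (f_i ⊗ B_i Σ_{E,i} - (1, …, 1)ᵀ ⊗ B_i Σ_{E,i})`, with `𝐀` the matrix of the
error dynamics. -/
def crossCov (P : Plant κ p m q) (i : Fin κ) (k : ℕ) :
    Matrix (Fin κ × Fin p) (Fin (q i)) ℝ :=
  P.errA ^ k * (P.errB i * P.covE i)

/-- The block of `Σ_{Δ,i,k}` that belongs to the observer error `δ_i` of subcontroller `i`. -/
def Q (P : Plant κ p m q) (i : Fin κ) (k : ℕ) : Matrix (Fin p) (Fin (q i)) ℝ :=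
  (P.crossCov i k).submatrix (fun a => (i, a)) id

/-- The `i`-th diagonal `p × p` block of a matrix with `κ × κ` blocks. -/
def diagBlock (T : Matrix (Fin κ × Fin p) (Fin κ × Fin p) ℝ) (i : Fin κ) :
    Matrix (Fin p) (Fin p) ℝ :=
  T.submatrix (fun a => (i, a)) (fun a => (i, a))

/-- The limit matrix `R_{i,j}`, formed with the lag `k` and with `T` in the role of `Σ_Δ`. -/
def R (P : Plant κ p m q) (T : Matrix (Fin κ × Fin p) (Fin κ × Fin p) ℝ) (i j : Fin κ) (k : ℕ) :
    Matrix (Fin (q i) ⊕ Fin (m j)) (Fin (q i) ⊕ Fin (m j)) ℝ :=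
  Matrix.fromBlocks (P.covE i) ((P.Q i k)ᵀ * (P.C j)ᵀ)
    (P.C j * P.Q i k) (P.C j * diagBlock T i * (P.C j)ᵀ + P.covZ j)

end Plant

/-- `X` is a zero-mean (jointly) Gaussian random vector with covariance matrix `V`. -/
structure IsCenteredGaussian {Ω : Type*} [MeasurableSpace Ω] {d : ℕ} (X : Ω → Fin d → ℝ)
    (V : Matrix (Fin d) (Fin d) ℝ) (μ : Measure Ω) : Prop where
  measurable : Measurable X
  gaussian : HasGaussianLaw X μ
  mean : ∀ a, ∫ ω, X ω a ∂μ = 0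
  cov : ∀ a b, covariance (fun ω => X ω a) (fun ω => X ω b) μ = V a b

/-- Labels of the independent sources of randomness. -/
inductive Source (κ : ℕ) where
  | init
  | process (n : ℕ)
  | meas (i : Fin κ) (n : ℕ)
  | excite (i : Fin κ) (n : ℕ)

/-- The σ-algebra generated by a source: the initial condition (all of it), or one noise or
excitation vector at one time. -/
abbrev sourceAlg {Ω : Type*} (S : Ω → Signals κ p m q) : Source κ → MeasurableSpace Ω
  | .init => MeasurableSpace.comap (fun ω => ((S ω).x0, (S ω).xhat0)) inferInstance
  | .process n => MeasurableSpace.comap (fun ω => (S ω).w n) inferInstance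
  | .meas i n => MeasurableSpace.comap (fun ω => (S ω).z i n) inferInstance
  | .excite i n => MeasurableSpace.comap (fun ω => (S ω).e i n) inferInstance

/-- The stochastic model: each of `w_n`, `z_{i,n}`, `e_{i,n}` is zero-mean Gaussian with the
covariance given by `P` (hence identically distributed in `n`), the initial condition is
integrable, and all of these are mutually independent. -/
structure NoiseModel {Ω : Type*} [MeasurableSpace Ω] (P : Plant κ p m q)
    (S : Ω → Signals κ p m q) (μ : Measure Ω) : Prop where
  measurable_init : Measurable fun ω => ((S ω).x0, (S ω).xhat0)
  integrable_x0 : Integrable (fun ω => (S ω).x0) μ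
  integrable_xhat0 : ∀ i, Integrable (fun ω => (S ω).xhat0 i) μ
  process : ∀ n, IsCenteredGaussian (fun ω => (S ω).w n) P.covW μ
  meas : ∀ i n, IsCenteredGaussian (fun ω => (S ω).z i n) (P.covZ i) μ
  excite : ∀ i n, IsCenteredGaussian (fun ω => (S ω).e i n) (P.covE i) μ
  indep : iIndep (sourceAlg S) μ

end NetLTI

/-! Without attacks the stacked observer error obeys `Δ (n + 1) = errA Δ n + noiseIn ξ n`, where `ξ
n` stacks `w`, all `z` and all `e`, and is centred, with fixed covariance, and independent of the
past (`Delta_succ`, `whiteNoise`). The matrix `errA` is Schur stable: differences of blocks evolve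
under `A + BK + LC`, and on vectors with equal blocks the feedback cancels, leaving `A + LC`
(`errA_schurStable`).

The error splits into the transient `errA ^ n Δ 0` and the zero-state response. The initial
condition is merely integrable, so no second moment of the transient is available; it tends to zero
along each path, which suffices for averages. The zero-state response is bounded in `L⁴`, so
products of its entries with each other or with the noise are bounded in `L²`, and a strong law for
orthogonal sequences applies to `ξ ξᵀ - V`, `X ξᵀ` and lagged `ξ ξᵀ` (`ae_tendsto_cesaro_mul`).

The rest is deterministic on each good path. Averaging the recursion for `X Xᵀ` shows that the
Lyapunov operator of the averages converges to the driving covariance, and this operator is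
invertible (`tendsto_cesaro_of_recursion`). Averaging `X ξᵀ` at increasing lags gives the powers of
`errA` in `crossCov`. Since `ψ` is linear in the error and the noise, its four blocks follow. The
means obey the noise-free recursion and hence decay. -/

namespace NetLTI

/-! ### Powers of Schur stable matrices and the discrete Lyapunov equation. -/

section Stable

variable {ι : Type*} [Fintype ι] [DecidableEq ι]

attribute [local instance] Matrix.linftyOpNormedRing Matrix.linftyOpNormedAlgebra in
/-- The powers of a Schur stable matrix are dominated by a summable sequence. -/
theorem SchurStable.exists_summable_bound {M : Matrix ι ι ℝ} (hM : SchurStable M) :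
    ∃ c : ℕ → ℝ, Summable c ∧ ∀ k (v : ι → ℝ), ‖M ^ k *ᵥ v‖ ≤ c k * ‖v‖ := by
  cases isEmpty_or_nonempty ι with
  | inl h =>
    exact ⟨0, summable_zero, fun k v => by simp [Subsingleton.elim _ (0 : ι → ℝ)]⟩
  | inr h =>
    set a : Matrix ι ι ℂ := M.map (algebraMap ℝ ℂ) with ha
    have hρ : spectralRadius ℂ a < (1 : NNReal) :=
      spectrum.spectralRadius_lt_of_forall_lt a fun z hz => by
        have := hM z hz
        rwa [← coe_nnnorm, ← NNReal.coe_one, NNReal.coe_lt_coe] at this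
    obtain ⟨r, hr, hr1⟩ := ENNReal.lt_iff_exists_nnreal_btwn.1 hρ
    have hr1' : r < 1 := by exact_mod_cast hr1
    -- Gelfand's formula: eventually `‖a ^ k‖ ≤ r ^ k` with `r < 1`, whence a geometric majorant.
    have hev := (spectrum.pow_nnnorm_pow_one_div_tendsto_nhds_spectralRadius a).eventually
      (gt_mem_nhds hr)
    have hs : Summable fun k => ‖a ^ k‖ := by
      refine Summable.of_norm_bounded_eventually_nat
        (summable_geometric_of_lt_one r.coe_nonneg (by exact_mod_cast hr1')) ?_
      filter_upwards [hev, eventually_gt_atTop 0] with k hk hk0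
      have h1 : ((‖a ^ k‖₊ : ENNReal) ^ (1 / k : ℝ)) ^ (k : ℝ) ≤ (r : ENNReal) ^ (k : ℝ) :=
        ENNReal.rpow_le_rpow hk.le (by positivity)
      rw [← ENNReal.rpow_mul, one_div, inv_mul_cancel₀ (by positivity), ENNReal.rpow_one,
        ENNReal.rpow_natCast] at h1
      rw [norm_norm]
      exact_mod_cast h1
    refine ⟨fun k => ‖a ^ k‖, hs, fun k v => ?_⟩
    -- The bound is obtained over `ℂ` and descends to `ℝ` because complexifying a real vector
    -- preserves its sup norm.
    have h1 := Matrix.linfty_opNorm_mulVec (a ^ k) (fun i => (v i : ℂ))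
    have h2 : a ^ k *ᵥ (fun i => (v i : ℂ)) = fun i => ((M ^ k *ᵥ v) i : ℂ) := by
      rw [ha, ← Matrix.map_pow]
      ext i
      simp [mulVec, dotProduct]
    have h3 : ∀ u : ι → ℝ, ‖fun i => (u i : ℂ)‖ = ‖u‖ := fun u => by
      simp [Pi.norm_def]
    rwa [h2, h3, h3] at h1

theorem SchurStable.tendsto_pow_mulVec {M : Matrix ι ι ℝ} (hM : SchurStable M) (v : ι → ℝ) :
    Tendsto (fun k => M ^ k *ᵥ v) atTop (𝓝 0) := by
  obtain ⟨c, hc, h⟩ := hM.exists_summable_bound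
  refine squeeze_zero_norm (fun k => h k v) ?_
  simpa using hc.tendsto_atTop_zero.mul_const ‖v‖

theorem SchurStable.tendsto_pow {M : Matrix ι ι ℝ} (hM : SchurStable M) :
    Tendsto (fun k => M ^ k) atTop (𝓝 0) := by
  refine tendsto_pi_nhds.2 fun a => tendsto_pi_nhds.2 fun b => ?_
  have := tendsto_pi_nhds.1 (hM.tendsto_pow_mulVec (Pi.single b 1)) a
  simpa using this

/-- The operator `X ↦ X - M X Mᵀ`. -/
def lyapunov (M : Matrix ι ι ℝ) : Matrix ι ι ℝ →ₗ[ℝ] Matrix ι ι ℝ where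
  toFun X := X - M * X * Mᵀ
  map_add' X Y := by simp only [Matrix.mul_add, Matrix.add_mul]; abel
  map_smul' c X := by simp [smul_sub]

theorem lyapunov_apply (M X : Matrix ι ι ℝ) : lyapunov M X = X - M * X * Mᵀ := rfl

theorem SchurStable.tendsto_conj_pow {M : Matrix ι ι ℝ} (hM : SchurStable M)
    (X : Matrix ι ι ℝ) : Tendsto (fun k => M ^ k * X * (M ^ k)ᵀ) atTop (𝓝 0) := by
  have h1 : Tendsto (fun k => (M ^ k)ᵀ) atTop (𝓝 0) := by
    have hc : Continuous fun X : Matrix ι ι ℝ => Xᵀ := by fun_prop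
    exact (hc.tendsto' 0 0 transpose_zero).comp hM.tendsto_pow
  simpa using (hM.tendsto_pow.mul (tendsto_const_nhds (x := X))).mul h1

/-- A kernel element is fixed by `X ↦ M X Mᵀ`, hence equals `M ^ k * X * (M ^ k)ᵀ` for all `k`,
which tends to zero. In finite dimension this also yields surjectivity. -/
theorem SchurStable.lyapunov_injective {M : Matrix ι ι ℝ} (hM : SchurStable M) :
    Function.Injective (lyapunov M) := by
  refine (injective_iff_map_eq_zero _).2 fun X hX => ?_
  rw [lyapunov_apply, sub_eq_zero] at hX
  have h : ∀ k, M ^ k * X * (M ^ k)ᵀ = X := fun k => by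
    induction k with
    | zero => simp
    | succ k ih =>
      calc M ^ (k + 1) * X * (M ^ (k + 1))ᵀ = M ^ k * (M * X * Mᵀ) * (M ^ k)ᵀ := by
            rw [pow_succ, transpose_mul]; simp only [Matrix.mul_assoc]
        _ = X := by rw [← hX, ih]
  have h2 := hM.tendsto_conj_pow X
  simp only [h] at h2
  exact tendsto_nhds_unique tendsto_const_nhds h2

/-- For Schur stable `M`, the Lyapunov operator is invertible. -/
noncomputable def lyapunovEquiv {M : Matrix ι ι ℝ} (hM : SchurStable M) :
    Matrix ι ι ℝ ≃ₗ[ℝ] Matrix ι ι ℝ :=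
  LinearEquiv.ofInjectiveEndo (lyapunov M) hM.lyapunov_injective

theorem lyapunovEquiv_apply {M : Matrix ι ι ℝ} (hM : SchurStable M) (X : Matrix ι ι ℝ) :
    lyapunovEquiv hM X = X - M * X * Mᵀ := rfl

theorem SchurStable.exists_lyapunov_solution {M : Matrix ι ι ℝ} (hM : SchurStable M)
    (W : Matrix ι ι ℝ) : ∃ T, T = M * T * Mᵀ + W := by
  refine ⟨(lyapunovEquiv hM).symm W, ?_⟩
  have h := (lyapunovEquiv hM).apply_symm_apply W
  rw [lyapunovEquiv_apply, sub_eq_iff_eq_add] at h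
  rw [add_comm]
  exact h

theorem SchurStable.lyapunov_solution_unique {M : Matrix ι ι ℝ} (hM : SchurStable M)
    {W T T' : Matrix ι ι ℝ} (h : T = M * T * Mᵀ + W) (h' : T' = M * T' * Mᵀ + W) : T' = T := by
  apply hM.lyapunov_injective
  rw [lyapunov_apply, lyapunov_apply, sub_eq_iff_eq_add'.2 h, sub_eq_iff_eq_add'.2 h']

/-- Symmetry comes from uniqueness, as `Tᵀ` solves the same equation. Positivity passes to the limit
from `T - M ^ k T (M ^ k)ᵀ`, which is the partial sum of the terms `M ^ i W (M ^ i)ᵀ`. -/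
theorem SchurStable.posSemidef_lyapunov_solution {M : Matrix ι ι ℝ} (hM : SchurStable M)
    {W T : Matrix ι ι ℝ} (hW : W.PosSemidef) (h : T = M * T * Mᵀ + W) : T.PosSemidef := by
  have hW' : Wᵀ = W := hW.1
  refine posSemidef_iff_dotProduct_mulVec.2 ⟨hM.lyapunov_solution_unique h ?_, fun x => ?_⟩
  · rw [conjTranspose_eq_transpose_of_trivial]
    conv_lhs => rw [h]
    simp only [transpose_add, transpose_mul, transpose_transpose, hW', Matrix.mul_assoc]
  · have hk : ∀ k, (T - M ^ k * T * (M ^ k)ᵀ).PosSemidef := fun k => by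
      induction k with
      | zero => simpa using PosSemidef.zero
      | succ k ih =>
        have e : T - M ^ (k + 1) * T * (M ^ (k + 1))ᵀ
            = (T - M ^ k * T * (M ^ k)ᵀ) + M ^ k * W * (M ^ k)ᴴ := by
          have : M ^ (k + 1) * T * (M ^ (k + 1))ᵀ = M ^ k * (T - W) * (M ^ k)ᵀ := by
            rw [sub_eq_iff_eq_add.2 h, pow_succ, transpose_mul]; simp only [Matrix.mul_assoc]
          rw [this, conjTranspose_eq_transpose_of_trivial, Matrix.mul_sub, Matrix.sub_mul]
          abel
        rw [e]
        exact ih.add (hW.mul_mul_conjTranspose_same _)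
    have hlim : Tendsto (fun k => T - M ^ k * T * (M ^ k)ᵀ) atTop (𝓝 T) := by
      simpa using tendsto_const_nhds.sub (hM.tendsto_conj_pow T)
    have hc : Continuous fun Y : Matrix ι ι ℝ => star x ⬝ᵥ Y *ᵥ x := by fun_prop
    exact ge_of_tendsto' ((hc.tendsto T).comp hlim) fun k => (hk k).dotProduct_mulVec_nonneg x

end Stable

/-! ### Stability of the error dynamics. -/

section ErrA

variable {κ p : ℕ} {m q : Fin κ → ℕ}

theorem Plant.errA_mulVec (P : Plant κ p m q) (v : Fin κ × Fin p → ℝ) (i : Fin κ) (a : Fin p) :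
    (P.errA *ᵥ v) (i, a) = ((P.A + P.BK + P.LC) *ᵥ fun b => v (i, b)) a
      - (∑ l, (P.B l * P.K l) *ᵥ fun b => v (l, b)) a := by
  simp [Plant.errA, mulVec, dotProduct, Fintype.sum_prod_type, kroneckerMap_apply,
    Matrix.one_apply, ite_mul, sub_mul, Finset.sum_sub_distrib]

theorem SchurStable.norm_lt_one {n : Type*} [Fintype n] [DecidableEq n] {M : Matrix n n ℝ}
    (hM : SchurStable M) {c : ℂ} {v : n → ℂ} (hv : v ≠ 0)
    (h : M.map (algebraMap ℝ ℂ) *ᵥ v = c • v) : ‖c‖ < 1 := by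
  refine hM c ?_
  rw [← Matrix.spectrum_toLin', ← Module.End.hasEigenvalue_iff_mem_spectrum]
  exact Module.End.hasEigenvalue_of_hasEigenvector (x := v)
    ⟨Module.End.mem_eigenspace_iff.2 (by simpa using h), hv⟩

theorem Plant.errA_schurStable (P : Plant κ p m q) (hLC : SchurStable (P.A + P.LC))
    (hBKLC : SchurStable (P.A + P.BK + P.LC)) : SchurStable P.errA := by
  intro c hc
  rw [← Matrix.spectrum_toLin', ← Module.End.hasEigenvalue_iff_mem_spectrum] at hc
  obtain ⟨v, hv⟩ := hc.exists_hasEigenvector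
  have hev : P.errA.map (algebraMap ℝ ℂ) *ᵥ v = c • v := by simpa using hv.apply_eq_smul
  set F := (P.A + P.BK + P.LC).map (algebraMap ℝ ℂ) with hF
  have key : ∀ i, F *ᵥ (fun b => v (i, b))
      - ∑ l, (P.B l * P.K l).map (algebraMap ℝ ℂ) *ᵥ (fun b => v (l, b))
      = c • fun b => v (i, b) := by
    intro i
    ext a
    have : _ = c • v (i, a) := congrFun hev (i, a)
    rw [Pi.smul_apply, ← this]
    simp [hF, Plant.errA, mulVec, dotProduct, Fintype.sum_prod_type,
      kroneckerMap_apply, Matrix.one_apply, ite_mul, sub_mul, Finset.sum_sub_distrib,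
      apply_ite Complex.ofReal]
  -- The coupling sum is the same in every block, so a nonzero difference of two blocks is an
  -- eigenvector of `A + BK + LC`. If all blocks agree, the sum acts as `BK` on the common block, an
  -- eigenvector of `A + LC`.
  by_cases hd : ∃ i j, (fun b => v (i, b)) - (fun b => v (j, b)) ≠ 0
  · obtain ⟨i, j, hij⟩ := hd
    refine hBKLC.norm_lt_one hij ?_
    rw [← hF, mulVec_sub, smul_sub, ← key i, ← key j]
    abel
  · push Not at hd
    have hne : ∃ i, (fun b => v (i, b)) ≠ 0 := by
      by_contra! h0
      exact hv.2 (funext fun ⟨i, b⟩ => congrFun (h0 i) b)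
    obtain ⟨i, hi⟩ := hne
    refine hLC.norm_lt_one hi ?_
    rw [← key i]
    have : ∀ l, (fun b => v (l, b)) = fun b => v (i, b) := fun l => sub_eq_zero.1 (hd l i)
    simp only [this]
    rw [← Matrix.sum_mulVec, ← Matrix.sub_mulVec]
    congr 1
    ext a b
    simp only [hF, Plant.BK, map_apply, Matrix.sub_apply, Matrix.sum_apply, Matrix.add_apply,
      map_add, map_sum]
    ring

end ErrA

/-! ### Cesàro averages and time shifts. -/

section Cesaro

variable {E : Type*} [AddCommGroup E] [Module ℝ E]

/-- The average of the first `N` terms of a sequence. -/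
noncomputable def cesaro (f : ℕ → E) (N : ℕ) : E := (N : ℝ)⁻¹ • ∑ n ∈ Finset.range N, f n

theorem cesaro_def (f : ℕ → E) :
    cesaro f = fun N : ℕ => (N : ℝ)⁻¹ • ∑ n ∈ Finset.range N, f n := rfl

theorem cesaro_add (f g : ℕ → E) (N : ℕ) :
    cesaro (fun n => f n + g n) N = cesaro f N + cesaro g N := by
  simp [cesaro, Finset.sum_add_distrib]

theorem cesaro_sub (f g : ℕ → E) (N : ℕ) :
    cesaro (fun n => f n - g n) N = cesaro f N - cesaro g N := by
  simp [cesaro, Finset.sum_sub_distrib, smul_sub]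

variable [TopologicalSpace E] [IsTopologicalAddGroup E] [ContinuousSMul ℝ E]

theorem tendsto_cesaro_succ_iff {f : ℕ → E} {l : E} :
    Tendsto (cesaro fun n => f (n + 1)) atTop (𝓝 l) ↔ Tendsto (cesaro f) atTop (𝓝 l) := by
  have h0 : Tendsto (fun N : ℕ => ((N + 1 : ℕ) : ℝ)⁻¹ • f 0) atTop (𝓝 0) := by
    have := (tendsto_inv_atTop_nhds_zero_nat (𝕜 := ℝ)).comp (tendsto_add_atTop_nat 1)
    simpa using this.smul_const (f 0)
  have h1 : Tendsto (fun N : ℕ => (N : ℝ) / ((N + 1 : ℕ) : ℝ)) atTop (𝓝 1) := by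
    simpa using tendsto_natCast_div_add_atTop (1 : ℝ)
  have h2 : Tendsto (fun N : ℕ => ((N + 1 : ℕ) : ℝ) / (N : ℝ)) atTop (𝓝 1) := by
    simpa using h1.inv₀ one_ne_zero
  have e : ∀ N : ℕ, cesaro f (N + 1) = ((N + 1 : ℕ) : ℝ)⁻¹ • f 0
      + ((N + 1 : ℕ) : ℝ)⁻¹ • ∑ n ∈ Finset.range N, f (n + 1) := fun N => by
    rw [cesaro, Finset.sum_range_succ', smul_add, add_comm]
  rw [← tendsto_add_atTop_iff_nat (f := cesaro f) 1]
  constructor <;> intro h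
  · have h3 := h0.add (h1.smul h)
    rw [zero_add, one_smul] at h3
    refine h3.congr' ?_
    filter_upwards [eventually_ne_atTop 0] with N hN
    have hN' : (N : ℝ) ≠ 0 := Nat.cast_ne_zero.2 hN
    rw [e, cesaro, smul_smul, div_mul_eq_mul_div, mul_inv_cancel₀ hN', one_div]
  · have h3 := h2.smul (h.sub h0)
    rw [sub_zero, one_smul] at h3
    refine h3.congr' ?_
    filter_upwards [eventually_ne_atTop 0] with N hN
    have hN' : ((N + 1 : ℕ) : ℝ) ≠ 0 := Nat.cast_ne_zero.2 N.succ_ne_zero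
    rw [e, add_sub_cancel_left, cesaro, smul_smul, div_mul_eq_mul_div, mul_inv_cancel₀ hN', one_div]

theorem tendsto_cesaro_add_iff {f : ℕ → E} {l : E} (k : ℕ) :
    Tendsto (cesaro fun n => f (n + k)) atTop (𝓝 l) ↔ Tendsto (cesaro f) atTop (𝓝 l) := by
  induction k with
  | zero => rfl
  | succ k ih =>
    rw [← ih, ← tendsto_cesaro_succ_iff (f := fun n => f (n + k))]
    simp only [add_assoc, add_comm 1 k]

end Cesaro

/-! ### Deterministic limits of averaged outer products along one path. -/

section Pathwise

variable {ι ο : Type*}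

theorem tendsto_cesaro_matrix_iff {f : ℕ → Matrix ι ο ℝ} {l : Matrix ι ο ℝ} :
    Tendsto (cesaro f) atTop (𝓝 l) ↔
      ∀ a b, Tendsto (cesaro fun n => f n a b) atTop (𝓝 (l a b)) := by
  have : ∀ a b N, cesaro f N a b = cesaro (fun n => f n a b) N := fun a b N => by
    simp [cesaro, Matrix.sum_apply]
  refine tendsto_pi_nhds.trans (forall_congr' fun a => tendsto_pi_nhds.trans
    (forall_congr' fun b => ?_))
  simp only [this]

/-- Cauchy–Schwarz for averages; `y` may be unbounded, only its mean square has to converge. -/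
theorem tendsto_cesaro_mul_of_tendsto_zero {r y : ℕ → ℝ} {l : ℝ} (hr : Tendsto r atTop (𝓝 0))
    (hy : Tendsto (cesaro fun n => y n * y n) atTop (𝓝 l)) :
    Tendsto (cesaro fun n => r n * y n) atTop (𝓝 0) := by
  have h1 : Tendsto (cesaro fun n => r n * r n) atTop (𝓝 0) := by
    simpa [cesaro_def] using (show Tendsto (fun n => r n * r n) atTop (𝓝 0) by
      simpa using hr.mul hr).cesaro
  have h2 : Tendsto (fun N => √(cesaro (fun n => r n * r n) N * cesaro (fun n => y n * y n) N))
      atTop (𝓝 0) := by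
    simpa using (h1.mul hy).sqrt
  refine squeeze_zero_norm (fun N => ?_) h2
  refine Real.abs_le_sqrt ?_
  have := Finset.sum_mul_sq_le_sq_mul_sq (Finset.range N) r y
  simp only [cesaro, smul_eq_mul, mul_pow, ← pow_two]
  calc _ ≤ ((N : ℝ)⁻¹ ^ 2) * ((∑ i ∈ Finset.range N, r i ^ 2) * ∑ i ∈ Finset.range N, y i ^ 2) := by
        gcongr
    _ = _ := by ring

/-- Serves to discard the transient due to the initial condition path by path, without any moment
assumption on it. -/
theorem tendsto_cesaro_vecMulVec_perturb {y r : ℕ → ι → ℝ} {l : Matrix ι ι ℝ}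
    (hy : Tendsto (cesaro fun n => vecMulVec (y n) (y n)) atTop (𝓝 l))
    (hr : Tendsto r atTop (𝓝 0)) :
    Tendsto (cesaro fun n => vecMulVec (y n + r n) (y n + r n)) atTop (𝓝 l) := by
  rw [tendsto_cesaro_matrix_iff] at hy ⊢
  intro a b
  have hra := tendsto_pi_nhds.1 hr a
  have hrb := tendsto_pi_nhds.1 hr b
  have hrr : Tendsto (cesaro fun n => r n a * r n b) atTop (𝓝 0) := by
    simpa [cesaro_def] using (show Tendsto (fun n => r n a * r n b) atTop (𝓝 0) by
      simpa using hra.mul hrb).cesaro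
  have h := ((hy a b).add (tendsto_cesaro_mul_of_tendsto_zero hra (hy b b))).add
    ((tendsto_cesaro_mul_of_tendsto_zero hrb (hy a a)).add hrr)
  simp only [add_zero] at h
  refine h.congr fun N => ?_
  rw [← cesaro_add, ← cesaro_add, ← cesaro_add]
  congr 1
  ext n
  simp only [vecMulVec_apply, Pi.add_apply]
  ring

theorem cesaro_transpose (f : ℕ → Matrix ι ο ℝ) (N : ℕ) :
    cesaro (fun n => (f n)ᵀ) N = (cesaro f N)ᵀ := by
  simp [cesaro, Matrix.transpose_sum]

theorem tendsto_cesaro_vecMulVec_swap {x : ℕ → ι → ℝ} {y : ℕ → ο → ℝ} {l : Matrix ι ο ℝ}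
    (h : Tendsto (cesaro fun n => vecMulVec (x n) (y n)) atTop (𝓝 l)) :
    Tendsto (cesaro fun n => vecMulVec (y n) (x n)) atTop (𝓝 lᵀ) := by
  have hc : Continuous fun X : Matrix ι ο ℝ => Xᵀ := by fun_prop
  refine ((hc.tendsto l).comp h).congr fun N => ?_
  rw [Function.comp_apply, ← cesaro_transpose]
  simp only [transpose_vecMulVec]

variable [Fintype ι] [Fintype ο]

theorem cesaro_mul_mul {α β : Type*} (L : Matrix α ι ℝ) (R : Matrix ο β ℝ)
    (f : ℕ → Matrix ι ο ℝ) (N : ℕ) :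
    cesaro (fun n => L * f n * R) N = L * cesaro f N * R := by
  simp [cesaro, Matrix.mul_sum, Matrix.sum_mul]

theorem vecMulVec_mulVec_mulVec {α β : Type*} (L : Matrix α ι ℝ) (R : Matrix β ο ℝ) (x : ι → ℝ)
    (y : ο → ℝ) : vecMulVec (L *ᵥ x) (R *ᵥ y) = L * vecMulVec x y * Rᵀ := by
  rw [mul_vecMulVec, vecMulVec_mul, vecMul_transpose]

theorem tendsto_cesaro_vecMulVec_mulVec {α β : Type*} (L : Matrix α ι ℝ) (R : Matrix β ο ℝ)
    {x : ℕ → ι → ℝ} {y : ℕ → ο → ℝ} {l : Matrix ι ο ℝ}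
    (h : Tendsto (cesaro fun n => vecMulVec (x n) (y n)) atTop (𝓝 l)) :
    Tendsto (cesaro fun n => vecMulVec (L *ᵥ x n) (R *ᵥ y n)) atTop (𝓝 (L * l * Rᵀ)) := by
  have hc : Continuous fun X : Matrix ι ο ℝ => L * X * Rᵀ := by fun_prop
  refine ((hc.tendsto l).comp h).congr fun N => ?_
  rw [Function.comp_apply, ← cesaro_mul_mul]
  simp only [vecMulVec_mulVec_mulVec]

variable [DecidableEq ι]

/-- The averages of `X Xᵀ` along a stable linear recursion converge to the solution of the
Lyapunov equation. -/
theorem tendsto_cesaro_of_recursion {M : Matrix ι ι ℝ} (hM : SchurStable M)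
    {H : Matrix ι ο ℝ} {V : Matrix ο ο ℝ} {T : Matrix ι ι ℝ} (hT : T = M * T * Mᵀ + H * V * Hᵀ)
    {X : ℕ → ι → ℝ} {ξ : ℕ → ο → ℝ} (hX : ∀ n, X (n + 1) = M *ᵥ X n + H *ᵥ ξ n)
    (hξ : Tendsto (cesaro fun n => vecMulVec (ξ n) (ξ n)) atTop (𝓝 V))
    (hXξ : Tendsto (cesaro fun n => vecMulVec (X n) (ξ n)) atTop (𝓝 0))
    (hXN : Tendsto (fun N : ℕ => (N : ℝ)⁻¹ • vecMulVec (X N) (X N)) atTop (𝓝 0)) :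
    Tendsto (cesaro fun n => vecMulVec (X n) (X n)) atTop (𝓝 T) := by
  set c := cesaro fun n => vecMulVec (X n) (X n) with hc
  have e1 : ∀ N, cesaro (fun n => vecMulVec (X (n + 1)) (X (n + 1))) N
      = M * c N * Mᵀ + M * cesaro (fun n => vecMulVec (X n) (ξ n)) N * Hᵀ
        + (H * cesaro (fun n => vecMulVec (ξ n) (X n)) N * Mᵀ
        + H * cesaro (fun n => vecMulVec (ξ n) (ξ n)) N * Hᵀ) := fun N => by
    rw [hc, ← cesaro_mul_mul, ← cesaro_mul_mul, ← cesaro_mul_mul, ← cesaro_mul_mul, ← cesaro_add,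
      ← cesaro_add, ← cesaro_add]
    simp only [← vecMulVec_mulVec_mulVec, hX, vecMulVec_add, add_vecMulVec]
    congr 1
    ext n : 1
    abel
  -- Telescoping: shifting the average by one changes it only by two boundary terms of weight `1 /
  -- N`.
  have e2 : ∀ N, cesaro (fun n => vecMulVec (X (n + 1)) (X (n + 1))) N
      = c N + ((N : ℝ)⁻¹ • vecMulVec (X N) (X N) - (N : ℝ)⁻¹ • vecMulVec (X 0) (X 0)) :=
    fun N => by
    have := Finset.sum_range_succ (fun n => vecMulVec (X n) (X n)) N
    rw [Finset.sum_range_succ', ← eq_sub_iff_add_eq] at this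
    rw [hc, cesaro, cesaro, this, smul_sub, smul_add]
    abel
  have hX0 : Tendsto (fun N : ℕ => (N : ℝ)⁻¹ • vecMulVec (X 0) (X 0)) atTop (𝓝 0) := by
    simpa using (tendsto_inv_atTop_nhds_zero_nat (𝕜 := ℝ)).smul_const (vecMulVec (X 0) (X 0))
  have h1 := (((tendsto_cesaro_vecMulVec_mulVec M H hXξ).add
    ((tendsto_cesaro_vecMulVec_mulVec H M (tendsto_cesaro_vecMulVec_swap hXξ)).add
    (tendsto_cesaro_vecMulVec_mulVec H H hξ))).sub (hXN.sub hX0))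
  -- Comparing `e1` with `e2` expresses `c N - M * c N * Mᵀ` through convergent terms; convergence
  -- of `c N` itself then follows from continuity of the inverse operator.
  have h2 : Tendsto (fun N => lyapunovEquiv hM (c N)) atTop (𝓝 (lyapunovEquiv hM T)) := by
    have e3 : lyapunovEquiv hM T = H * V * Hᵀ := by
      rw [lyapunovEquiv_apply, sub_eq_iff_eq_add'.2 hT]
    rw [e3]
    simp only [Matrix.mul_zero, Matrix.zero_mul, transpose_zero, zero_add, sub_zero] at h1
    refine h1.congr fun N => ?_
    simp only [vecMulVec_mulVec_mulVec, cesaro_mul_mul]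
    have := (e1 N).symm.trans (e2 N)
    rw [lyapunovEquiv_apply]
    rw [← sub_eq_zero] at this ⊢
    rw [← this, ← sub_eq_zero]
    abel
  have hcont : Continuous (lyapunovEquiv hM).symm :=
    (lyapunovEquiv hM).symm.toLinearMap.continuous_of_finiteDimensional
  simpa [Function.comp_def] using (hcont.tendsto _).comp h2

/-- Averages of the products of the state with the past noise along a linear recursion. -/
theorem tendsto_cesaro_lag_of_recursion {M : Matrix ι ι ℝ}
    {H : Matrix ι ο ℝ} {V : Matrix ο ο ℝ}
    {X : ℕ → ι → ℝ} {ξ : ℕ → ο → ℝ} (hX : ∀ n, X (n + 1) = M *ᵥ X n + H *ᵥ ξ n)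
    (hξ : Tendsto (cesaro fun n => vecMulVec (ξ n) (ξ n)) atTop (𝓝 V))
    (hξlag : ∀ k, Tendsto (cesaro fun n => vecMulVec (ξ (n + (k + 1))) (ξ n)) atTop (𝓝 0))
    (hXξ : Tendsto (cesaro fun n => vecMulVec (X n) (ξ n)) atTop (𝓝 0)) (k : ℕ) :
    Tendsto (cesaro fun n => vecMulVec (X (n + (k + 1))) (ξ n)) atTop (𝓝 (M ^ k * (H * V))) := by
  classical
  -- One step of the recursion raises the lag by one. The noise contributes `V' = V` only at `j =
  -- 0`, where the state term vanishes; at later steps `V' = 0`.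
  have hstep : ∀ j (U : Matrix ι ο ℝ) (V' : Matrix ο ο ℝ),
      Tendsto (cesaro fun n => vecMulVec (X (n + j)) (ξ n)) atTop (𝓝 U) →
      Tendsto (cesaro fun n => vecMulVec (ξ (n + j)) (ξ n)) atTop (𝓝 V') →
      Tendsto (cesaro fun n => vecMulVec (X (n + (j + 1))) (ξ n)) atTop (𝓝 (M * U + H * V')) := by
    intro j U V' hU hV'
    have h := (tendsto_cesaro_vecMulVec_mulVec M (1 : Matrix ο ο ℝ) hU).add (tendsto_cesaro_vecMulVec_mulVec H (1 : Matrix ο ο ℝ) hV')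
    simp only [transpose_one, Matrix.mul_one, one_mulVec] at h
    refine h.congr fun N => ?_
    rw [← cesaro_add]
    simp only [← add_assoc, hX, add_vecMulVec]
  induction k with
  | zero => simpa using hstep 0 0 V hXξ hξ
  | succ k ih => simpa [pow_succ', Matrix.mul_assoc] using hstep (k + 1) _ 0 ih (hξlag k)

end Pathwise

/-! ### A strong law for orthogonal sequences bounded in `L²`. -/

section StrongLaw

variable {Ω : Type*} {mΩ : MeasurableSpace Ω} {μ : Measure Ω}

/-- By Tonelli the sum of the `g n` has finite integral, so almost surely the series converges and
its terms vanish. -/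
theorem ae_tendsto_zero_of_summable_integral {g : ℕ → Ω → ℝ} (h0 : ∀ n ω, 0 ≤ g n ω)
    (hg : ∀ n, Integrable (g n) μ) (hs : Summable fun n => ∫ ω, g n ω ∂μ) :
    ∀ᵐ ω ∂μ, Tendsto (fun n => g n ω) atTop (𝓝 0) := by
  have hm : ∀ n, AEMeasurable (fun ω => ENNReal.ofReal (g n ω)) μ :=
    fun n => (hg n).aestronglyMeasurable.aemeasurable.ennreal_ofReal
  have h1 : ∫⁻ ω, ∑' n, ENNReal.ofReal (g n ω) ∂μ ≠ ⊤ := by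
    rw [lintegral_tsum hm]
    simp only [← ofReal_integral_eq_lintegral_ofReal (hg _) (Eventually.of_forall (h0 _))]
    exact hs.tsum_ofReal_ne_top
  filter_upwards [ae_lt_top' (AEMeasurable.tsum hm) h1] with ω hω
  have h2 := (ENNReal.tendsto_toReal ENNReal.zero_ne_top).comp
    (ENNReal.tendsto_atTop_zero_of_tsum_ne_top hω.ne)
  simpa [Function.comp_def, ENNReal.toReal_ofReal (h0 _ ω)] using h2

/-- A sequence of random vectors that is bounded in `L^r`. -/
def BddLp {E : Type*} [NormedAddCommGroup E] (f : ℕ → Ω → E) (r : ENNReal) (μ : Measure Ω) : Prop :=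
  ∃ C : ENNReal, C ≠ ⊤ ∧ ∀ n, AEStronglyMeasurable (f n) μ ∧ eLpNorm (f n) r μ ≤ C

namespace BddLp

variable {E : Type*} [NormedAddCommGroup E]

theorem memLp {f : ℕ → Ω → E} {r : ENNReal} (hf : BddLp f r μ) (n : ℕ) : MemLp (f n) r μ := by
  obtain ⟨C, hC, h⟩ := hf
  exact ⟨(h n).1, (h n).2.trans_lt hC.lt_top⟩

theorem eval {ι : Type*} [Fintype ι] {f : ℕ → Ω → ι → ℝ} {r : ENNReal} (hf : BddLp f r μ) (a : ι) :
    BddLp (fun n ω => f n ω a) r μ := by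
  obtain ⟨C, hC, h⟩ := hf
  exact ⟨C, hC, fun n => ⟨((continuous_apply a).comp_aestronglyMeasurable (h n).1),
    (eLpNorm_mono fun ω => norm_le_pi_norm _ a).trans (h n).2⟩⟩

theorem shift {f : ℕ → Ω → E} {r : ENNReal} (hf : BddLp f r μ) (k : ℕ) :
    BddLp (fun n => f (n + k)) r μ := by
  obtain ⟨C, hC, h⟩ := hf
  exact ⟨C, hC, fun n => h (n + k)⟩

/-- Hölder with `1/4 + 1/4 = 1/2`: fourth moments of the factors put the products within reach of
the `L²` strong law. -/
theorem mul {f g : ℕ → Ω → ℝ} (hf : BddLp f 4 μ) (hg : BddLp g 4 μ) :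
    BddLp (fun n ω => f n ω * g n ω) 2 μ := by
  obtain ⟨C, hC, h⟩ := hf
  obtain ⟨C', hC', h'⟩ := hg
  have : ENNReal.HolderTriple 4 4 2 := ⟨by
    rw [← two_mul, show (4 : ENNReal) = 2 * 2 by norm_num,
      ENNReal.mul_inv (by simp) (by simp), ← mul_assoc,
      ENNReal.mul_inv_cancel (by simp) (by simp), one_mul]⟩
  exact ⟨C * C', ENNReal.mul_ne_top hC hC', fun n => ⟨(h n).1.mul (h' n).1,
    (eLpNorm_smul_le_mul_eLpNorm (h' n).1 (h n).1).trans (mul_le_mul' (h n).2 (h' n).2)⟩⟩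

theorem sub_const [IsProbabilityMeasure μ] {f : ℕ → Ω → ℝ} (hf : BddLp f 2 μ) (c : ℝ) :
    BddLp (fun n ω => f n ω - c) 2 μ := by
  obtain ⟨C, hC, h⟩ := hf
  have hc : MemLp (fun _ : Ω => c) 2 μ := memLp_const c
  exact ⟨C + eLpNorm (fun _ : Ω => c) 2 μ, ENNReal.add_ne_top.2 ⟨hC, hc.2.ne⟩, fun n =>
    ⟨(h n).1.sub hc.1, (eLpNorm_sub_le (h n).1 hc.1 (by norm_num)).trans
      (add_le_add_left (h n).2 _)⟩⟩

theorem integral_sq_le {f : ℕ → Ω → ℝ} (hf : BddLp f 2 μ) :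
    ∃ C : ℝ, 0 ≤ C ∧ ∀ n, ∫ ω, f n ω ^ 2 ∂μ ≤ C := by
  obtain ⟨C, hC, h⟩ := id hf
  refine ⟨C.toReal ^ 2, by positivity, fun n => ?_⟩
  have h0 : 0 ≤ ∫ ω, f n ω ^ 2 ∂μ := integral_nonneg fun ω => sq_nonneg _
  have h1 := (hf.memLp n).eLpNorm_eq_integral_rpow_norm (by norm_num) (by norm_num)
  have h2 := (h n).2
  rw [h1, ENNReal.ofReal_le_iff_le_toReal hC] at h2
  norm_num at h2
  rw [← Real.sqrt_eq_rpow] at h2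
  exact (Real.sqrt_le_left ENNReal.toReal_nonneg).1 h2

/-- The second moments of `f n / n` are at most `C / n ^ 2`, hence summable. This disposes of the
boundary term `X N (X N)ᵀ / N`. -/
theorem ae_tendsto_inv_mul {f : ℕ → Ω → ℝ} (hf : BddLp f 2 μ) :
    ∀ᵐ ω ∂μ, Tendsto (fun n : ℕ => (n : ℝ)⁻¹ * f n ω) atTop (𝓝 0) := by
  obtain ⟨C, hC0, hC⟩ := hf.integral_sq_le
  have hi : ∀ n : ℕ, Integrable (fun ω => ((n : ℝ)⁻¹ * f n ω) ^ 2) μ := fun n =>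
    ((hf.memLp n).const_mul _).integrable_sq
  have hs : Summable fun n : ℕ => ∫ ω, ((n : ℝ)⁻¹ * f n ω) ^ 2 ∂μ := by
    refine Summable.of_nonneg_of_le (fun n => integral_nonneg fun ω => sq_nonneg _) (fun n => ?_)
      ((Real.summable_nat_pow_inv.2 one_lt_two).mul_right C)
    simp only [mul_pow, integral_const_mul, inv_pow]
    gcongr
    exact hC n
  filter_upwards [ae_tendsto_zero_of_summable_integral (fun n ω => sq_nonneg _) hi hs] with ω hω
  have := hω.sqrt
  simp only [Real.sqrt_sq_eq_abs, Real.sqrt_zero] at this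
  exact (tendsto_zero_iff_abs_tendsto_zero _).2 this

end BddLp

theorem integral_sq_sum_le {D : ℕ → Ω → ℝ} (hD : ∀ n, MemLp (D n) 2 μ) {C : ℝ}
    (hC : ∀ n, ∫ ω, D n ω ^ 2 ∂μ ≤ C) (ho : ∀ m n, m < n → ∫ ω, D m ω * D n ω ∂μ = 0) (N : ℕ) :
    ∫ ω, (∑ n ∈ Finset.range N, D n ω) ^ 2 ∂μ ≤ C * N := by
  induction N with
  | zero => simp
  | succ N ih =>
    have hS : MemLp (fun ω => ∑ n ∈ Finset.range N, D n ω) 2 μ :=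
      memLp_finsetSum _ fun n _ => hD n
    have e : ∀ ω, (∑ n ∈ Finset.range (N + 1), D n ω) ^ 2
        = (∑ n ∈ Finset.range N, D n ω) ^ 2
          + (2 * ∑ n ∈ Finset.range N, D n ω * D N ω + D N ω ^ 2) := fun ω => by
      rw [Finset.sum_range_succ, ← Finset.sum_mul]; ring
    have hi : ∀ n, Integrable (fun ω => D n ω * D N ω) μ := fun n =>
      (hD n).integrable_mul (hD N)
    have hi' : Integrable (fun ω => 2 * ∑ n ∈ Finset.range N, D n ω * D N ω) μ :=
      (integrable_finsetSum _ fun n _ => hi n).const_mul 2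
    simp only [e]
    rw [integral_add hS.integrable_sq (g := fun ω => 2 * ∑ n ∈ Finset.range N, D n ω * D N ω
        + D N ω ^ 2) (hi'.add (hD N).integrable_sq), integral_add hi' (hD N).integrable_sq, integral_const_mul,
      integral_finsetSum _ fun n _ => hi n,
      Finset.sum_eq_zero fun n hn => ho n N (Finset.mem_range.1 hn)]
    push_cast
    linarith [hC N]

/-- Strong law of large numbers for orthogonal sequences that are bounded in `L²`. -/
theorem ae_tendsto_cesaro_of_orthogonal {D : ℕ → Ω → ℝ} (hD : BddLp D 2 μ)
    (ho : ∀ m n, m < n → ∫ ω, D m ω * D n ω ∂μ = 0) :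
    ∀ᵐ ω ∂μ, Tendsto (cesaro fun n => D n ω) atTop (𝓝 0) := by
  obtain ⟨C, hC0, hC⟩ := hD.integral_sq_le
  set S : ℕ → Ω → ℝ := fun N ω => ∑ n ∈ Finset.range N, D n ω with hS
  -- Partial sums are controlled at the squares `k ^ 2`. Between consecutive squares there are `2 *
  -- k + 1` terms, so by Cauchy–Schwarz `U k` bounds the squared increment of `S` over any initial
  -- piece of the block.
  set U : ℕ → Ω → ℝ := fun k ω =>
    (2 * k + 1) * ∑ n ∈ Finset.Ico (k ^ 2) ((k + 1) ^ 2), D n ω ^ 2 with hU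
  have hSi : ∀ N, Integrable (fun ω => S N ω ^ 2) μ := fun N =>
    (memLp_finsetSum _ fun n _ => hD.memLp n).integrable_sq
  have hUi : ∀ k, Integrable (U k) μ := fun k =>
    (integrable_finsetSum _ fun n _ => (hD.memLp n).integrable_sq).const_mul _
  have hcard : ∀ k : ℕ, (k + 1) ^ 2 - k ^ 2 = 2 * k + 1 := fun k => by
    rw [show (k + 1) ^ 2 = (2 * k + 1) + k ^ 2 by ring, Nat.add_sub_cancel]
  have hUint : ∀ k : ℕ, ∫ ω, U k ω ∂μ ≤ (2 * k + 1) ^ 2 * C := fun k => by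
    rw [integral_const_mul, integral_finsetSum _ fun n _ => (hD.memLp n).integrable_sq]
    have h := Finset.sum_le_card_nsmul (Finset.Ico (k ^ 2) ((k + 1) ^ 2))
      (fun n => ∫ ω, D n ω ^ 2 ∂μ) C fun n _ => hC n
    rw [Nat.card_Ico, hcard, nsmul_eq_mul] at h
    push_cast at h
    calc _ ≤ (2 * k + 1 : ℝ) * ((2 * k + 1) * C) := by gcongr
      _ = _ := by ring
  -- Orthogonality makes the bracket `O(k ^ 2)` in mean, so the integrals of `g k` are `O(k⁻²)`; the
  -- constant `5 * C` comes from `k² + (2k + 1)² ≤ 5 (k + 1)²`.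
  set g : ℕ → Ω → ℝ := fun k ω => (((k : ℝ) + 1) ^ 4)⁻¹ * (S (k ^ 2) ω ^ 2 + U k ω) with hg
  have hU0 : ∀ k ω, 0 ≤ U k ω := fun k ω =>
    mul_nonneg (by positivity) (Finset.sum_nonneg fun n _ => sq_nonneg _)
  have hg0 : ∀ k ω, 0 ≤ g k ω := fun k ω =>
    mul_nonneg (by positivity) (add_nonneg (sq_nonneg _) (hU0 k ω))
  have hgs : Summable fun k => ∫ ω, g k ω ∂μ := by
    have hs := ((summable_nat_add_iff 1).2 (Real.summable_nat_pow_inv.2 one_lt_two)).mul_right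
      (5 * C)
    refine Summable.of_nonneg_of_le (fun n => integral_nonneg fun ω => hg0 n ω) (fun k => ?_) hs
    rw [integral_const_mul, integral_add (hSi _) (hUi k)]
    have h1 := integral_sq_sum_le hD.memLp hC ho (k ^ 2)
    have h2 := hUint k
    have h3 : C * k ^ 2 + (2 * k + 1) ^ 2 * C ≤ (5 * C) * ((k : ℝ) + 1) ^ 2 := by
      nlinarith [(Nat.cast_nonneg k : (0 : ℝ) ≤ k), mul_nonneg hC0 (Nat.cast_nonneg k : (0 : ℝ) ≤ k)]
    push_cast at h1 ⊢
    calc _ ≤ (((k : ℝ) + 1) ^ 4)⁻¹ * ((5 * C) * ((k : ℝ) + 1) ^ 2) := by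
          gcongr
          exact (add_le_add h1 h2).trans h3
      _ = _ := by
          field_simp
  filter_upwards [ae_tendsto_zero_of_summable_integral hg0
    (fun k => ((hSi _).add (hUi k)).const_mul _) hgs] with ω hω
  have hsqrt : Tendsto Nat.sqrt atTop atTop := by
    refine tendsto_atTop.2 fun b => ?_
    filter_upwards [eventually_ge_atTop (b * b)] with N hN using Nat.le_sqrt.2 hN
  -- `32 = 2 * 16`: the `2` is from `(a + b)² ≤ 2a² + 2b²`, the `16` from `(k + 1) ^ 4 ≤ 16 N²` for
  -- `k = √N` rounded down.
  have h2 : Tendsto (fun N => √(32 * g (Nat.sqrt N) ω)) atTop (𝓝 0) := by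
    simpa using ((hω.comp hsqrt).const_mul 32).sqrt
  refine squeeze_zero_norm' ?_ h2
  filter_upwards [eventually_gt_atTop 0] with N hN
  refine Real.abs_le_sqrt ?_
  set k := Nat.sqrt N with hk
  have hk1 : k ^ 2 ≤ N := by rw [pow_two]; exact Nat.sqrt_le N
  have hk2 : N ≤ (k + 1) ^ 2 := by rw [pow_two]; exact (Nat.lt_succ_sqrt N).le
  have hk0 : 1 ≤ k := Nat.sqrt_pos.2 hN
  have hN' : (0 : ℝ) < N := by exact_mod_cast hN
  have hsplit : S N ω = S (k ^ 2) ω + ∑ n ∈ Finset.Ico (k ^ 2) N, D n ω :=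
    (Finset.sum_range_add_sum_Ico _ hk1).symm
  have hrest : (∑ n ∈ Finset.Ico (k ^ 2) N, D n ω) ^ 2 ≤ U k ω := by
    refine sq_sum_le_card_mul_sum_sq.trans ?_
    rw [Nat.card_Ico]
    refine mul_le_mul ?_ (Finset.sum_le_sum_of_subset_of_nonneg
      (Finset.Ico_subset_Ico_right hk2) fun n _ _ => sq_nonneg _)
      (Finset.sum_nonneg fun n _ => sq_nonneg _) (by positivity)
    have : N - k ^ 2 ≤ 2 * k + 1 := by rw [← hcard]; exact Nat.sub_le_sub_right hk2 _
    exact_mod_cast this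
  have hk4 : ((k : ℝ) + 1) ^ 4 ≤ 16 * (N : ℝ) ^ 2 := by
    have h3 : ((k : ℝ) + 1) ^ 2 ≤ 4 * N := by
      have : (k + 1) ^ 2 ≤ 4 * N := by nlinarith
      exact_mod_cast this
    nlinarith [sq_nonneg ((k : ℝ) + 1)]
  have hS2 : S N ω ^ 2 ≤ 2 * (S (k ^ 2) ω ^ 2 + U k ω) := by
    rw [hsplit]
    nlinarith [sq_nonneg (S (k ^ 2) ω - ∑ n ∈ Finset.Ico (k ^ 2) N, D n ω)]
  have hsum0 : 0 ≤ S (k ^ 2) ω ^ 2 + U k ω := add_nonneg (sq_nonneg _) (hU0 k ω)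
  calc (cesaro (fun n => D n ω) N) ^ 2 = ((N : ℝ) ^ 2)⁻¹ * S N ω ^ 2 := by
        rw [cesaro, smul_eq_mul, mul_pow, inv_pow]
    _ ≤ ((N : ℝ) ^ 2)⁻¹ * (2 * (S (k ^ 2) ω ^ 2 + U k ω)) := by gcongr
    _ = 32 * ((16 * (N : ℝ) ^ 2)⁻¹ * (S (k ^ 2) ω ^ 2 + U k ω)) := by
        rw [mul_inv]; ring
    _ ≤ 32 * ((((k : ℝ) + 1) ^ 4)⁻¹ * (S (k ^ 2) ω ^ 2 + U k ω)) := by gcongr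

/-- Independence factors the integral under measurability alone; if `Y` is not integrable its
integral is zero by convention and the product formula still holds. -/
theorem integral_mul_eq_zero_of_indep {F : MeasurableSpace Ω} (hF : F ≤ mΩ) {Y ζ : Ω → ℝ}
    (hY : Measurable[F] Y) (hζ : Measurable[mΩ] ζ)
    (hind : Indep F (MeasurableSpace.comap ζ inferInstance) μ)
    (h0 : ∫ ω, ζ ω ∂μ = 0) : ∫ ω, Y ω * ζ ω ∂μ = 0 := by
  have hi : IndepFun Y ζ μ := indep_of_indep_of_le_left hind hY.comap_le
  have := hi.integral_mul_eq_mul_integral (hY.mono hF le_rfl).aestronglyMeasurable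
    hζ.aestronglyMeasurable
  rw [h0, mul_zero] at this
  exact this

/-- Strong law of large numbers for martingale differences `Y n * ζ n` with `ζ n` centred and
independent of the past. -/
theorem ae_tendsto_cesaro_mul {F : ℕ → MeasurableSpace Ω} (hmono : Monotone F) (hF : ∀ n, F n ≤ mΩ)
    {Y ζ : ℕ → Ω → ℝ} (hY : ∀ n, Measurable[F n] (Y n)) (hζ : ∀ n, Measurable[F (n + 1)] (ζ n))
    (hind : ∀ n, Indep (F n) (MeasurableSpace.comap (ζ n) inferInstance) μ)
    (h0 : ∀ n, ∫ ω, ζ n ω ∂μ = 0) (hb : BddLp (fun n ω => Y n ω * ζ n ω) 2 μ) :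
    ∀ᵐ ω ∂μ, Tendsto (cesaro fun n => Y n ω * ζ n ω) atTop (𝓝 0) := by
  refine ae_tendsto_cesaro_of_orthogonal hb fun m n hmn => ?_
  -- For `m < n` the factor `Y m * ζ m * Y n` is measurable with respect to `F n`, of which `ζ n` is
  -- independent.
  simp only [← mul_assoc]
  have hYm : Measurable[F n] (Y m) := (hY m).mono (hmono hmn.le) le_rfl
  have hζm : Measurable[F n] (ζ m) := (hζ m).mono (hmono hmn) le_rfl
  exact integral_mul_eq_zero_of_indep (hF n) ((hYm.mul hζm).mul (hY n))
    ((hζ n).mono (hF _) le_rfl) (hind n) (h0 n)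

end StrongLaw

/-! ### The forced response of a linear recursion. -/

section ZeroState

variable {ι : Type*} [Fintype ι] [DecidableEq ι]

/-- The solution of `x (n + 1) = M x n + u n` with `x 0 = 0`. -/
def zeroState (M : Matrix ι ι ℝ) (u : ℕ → ι → ℝ) (n : ℕ) : ι → ℝ :=
  ∑ k ∈ Finset.range n, M ^ k *ᵥ u (n - 1 - k)

theorem zeroState_succ (M : Matrix ι ι ℝ) (u : ℕ → ι → ℝ) (n : ℕ) :
    zeroState M u (n + 1) = M *ᵥ zeroState M u n + u n := by
  rw [zeroState, Finset.sum_range_succ', zeroState, mulVec_sum]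
  congr 1
  · refine Finset.sum_congr rfl fun k _ => ?_
    rw [pow_succ', ← mulVec_mulVec]
    congr 3
    omega
  · simp

theorem eq_add_zeroState {M : Matrix ι ι ℝ} {u x : ℕ → ι → ℝ}
    (h : ∀ n, x (n + 1) = M *ᵥ x n + u n) (n : ℕ) : x n = M ^ n *ᵥ x 0 + zeroState M u n := by
  induction n with
  | zero => simp [zeroState]
  | succ n ih =>
    rw [h, zeroState_succ]
    conv_lhs => rw [ih]
    rw [mulVec_add, mulVec_mulVec, ← pow_succ', add_assoc]

end ZeroState

/-! ### Linear recursions driven by white noise. -/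

/-- A centred `L⁴`-bounded noise with covariance `V`, adapted to a filtration of which it is
independent at each step. -/
structure WhiteNoise {Ω ο : Type*} [mΩ : MeasurableSpace Ω] (F : ℕ → MeasurableSpace Ω)
    [Fintype ο] (ξ : ℕ → Ω → ο → ℝ) (V : Matrix ο ο ℝ) (μ : Measure Ω) : Prop where
  mono : Monotone F
  le : ∀ n, F n ≤ mΩ
  adapted : ∀ n, Measurable[F (n + 1)] (ξ n)
  indep : ∀ n, Indep (F n) (MeasurableSpace.comap (ξ n) inferInstance) μ
  bdd : BddLp ξ 4 μ
  mean : ∀ n a, ∫ ω, ξ n ω a ∂μ = 0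
  cov : ∀ n a b, ∫ ω, ξ n ω a * ξ n ω b ∂μ = V a b

namespace WhiteNoise

variable {Ω ι ο : Type*} [mΩ : MeasurableSpace Ω] {μ : Measure Ω} [IsProbabilityMeasure μ]
  {F : ℕ → MeasurableSpace Ω} [Fintype ι] [DecidableEq ι] [Fintype ο] {ξ : ℕ → Ω → ο → ℝ}
  {V : Matrix ο ο ℝ}

omit [IsProbabilityMeasure μ] in
theorem adapted_eval (h : WhiteNoise F ξ V μ) (n : ℕ) (a : ο) :
    Measurable[F (n + 1)] fun ω => ξ n ω a :=
  (measurable_pi_apply a).comp (h.adapted n)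

omit [IsProbabilityMeasure μ] in
theorem measurable_eval (h : WhiteNoise F ξ V μ) (n : ℕ) (a : ο) : Measurable fun ω => ξ n ω a :=
  (h.adapted_eval n a).mono (h.le _) le_rfl

omit [IsProbabilityMeasure μ] in
theorem indep_eval (h : WhiteNoise F ξ V μ) (n : ℕ) (a : ο) :
    Indep (F n) (MeasurableSpace.comap (fun ω => ξ n ω a) inferInstance) μ := by
  refine indep_of_indep_of_le_right (h.indep n) ?_
  exact ((measurable_pi_apply a).comp (comap_measurable (ξ n))).comap_le

theorem memLp_two (h : WhiteNoise F ξ V μ) (n : ℕ) (a : ο) : MemLp (fun ω => ξ n ω a) 2 μ :=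
  ((h.bdd.eval a).memLp n).mono_exponent (by norm_num)

theorem integrable (h : WhiteNoise F ξ V μ) (n : ℕ) (a : ο) : Integrable (fun ω => ξ n ω a) μ :=
  (h.memLp_two n a).integrable one_le_two

theorem integrable_mul (h : WhiteNoise F ξ V μ) (n k : ℕ) (a b : ο) :
    Integrable (fun ω => ξ n ω a * ξ k ω b) μ :=
  (h.memLp_two n a).integrable_mul (h.memLp_two k b)

/-- The quadratic form of `V` at `x` is the second moment of `x ⬝ᵥ ξ 0`. -/
theorem posSemidef (h : WhiteNoise F ξ V μ) : V.PosSemidef := by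
  refine posSemidef_iff_dotProduct_mulVec.2 ⟨?_, fun x => ?_⟩
  · ext a b
    simp [← h.cov 0, mul_comm]
  · have hi : ∀ a b, Integrable (fun ω => x a * x b * (ξ 0 ω a * ξ 0 ω b)) μ := fun a b =>
      (h.integrable_mul 0 0 a b).const_mul _
    have hsq : ∀ ω, (∑ a, x a * ξ 0 ω a) ^ 2 = ∑ a, ∑ b, x a * x b * (ξ 0 ω a * ξ 0 ω b) :=
      fun ω => by simp only [pow_two, Finset.sum_mul_sum, mul_mul_mul_comm]
    have e : star x ⬝ᵥ V *ᵥ x = ∫ ω, (∑ a, x a * ξ 0 ω a) ^ 2 ∂μ := by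
      simp only [hsq]
      rw [integral_finsetSum _ fun a _ => integrable_finsetSum _ fun b _ => hi a b]
      simp only [integral_finsetSum _ fun b _ => hi _ b, integral_const_mul, h.cov, dotProduct,
        mulVec, Finset.mul_sum, Pi.star_apply, star_trivial]
      exact Finset.sum_congr rfl fun a _ => Finset.sum_congr rfl fun b _ => by ring
    rw [e]
    exact integral_nonneg fun ω => sq_nonneg _

theorem ae_tendsto_cesaro_sq (h : WhiteNoise F ξ V μ) :
    ∀ᵐ ω ∂μ, Tendsto (cesaro fun n => vecMulVec (ξ n ω) (ξ n ω)) atTop (𝓝 V) := by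
  -- The centred products are martingale differences themselves, hence the constant factor `1`.
  have key : ∀ a b, ∀ᵐ ω ∂μ,
      Tendsto (cesaro fun n => (1 : ℝ) * (ξ n ω a * ξ n ω b - V a b)) atTop (𝓝 0) := fun a b => by
    refine ae_tendsto_cesaro_mul (Y := fun _ _ => 1)
      (ζ := fun n ω => ξ n ω a * ξ n ω b - V a b) h.mono h.le
      (fun n => measurable_const) (fun n => ?_) (fun n => ?_) (fun n => ?_) ?_
    · exact ((h.adapted_eval n a).mul (h.adapted_eval n b)).sub_const _
    · refine indep_of_indep_of_le_right (h.indep n) ?_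
      have hm : Measurable fun x : ο → ℝ => x a * x b - V a b := by fun_prop
      exact (hm.comp (comap_measurable (ξ n))).comap_le
    · rw [integral_sub (h.integrable_mul n n a b) (integrable_const _), h.cov]
      simp
    · simpa using ((h.bdd.eval a).mul (h.bdd.eval b)).sub_const (V a b)
  filter_upwards [ae_all_iff.2 fun a => ae_all_iff.2 fun b => key a b] with ω hω
  refine tendsto_cesaro_matrix_iff.2 fun a b => ?_
  have hc : Tendsto (cesaro fun _ => V a b) atTop (𝓝 (V a b)) := by
    simpa [cesaro_def] using (tendsto_const_nhds (x := V a b) (f := atTop (α := ℕ))).cesaro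
  have h2 := (hω a b).add hc
  rw [zero_add] at h2
  refine h2.congr fun N => ?_
  rw [← cesaro_add]
  simp [vecMulVec_apply]

omit [DecidableEq ι] [IsProbabilityMeasure μ] in
theorem ae_tendsto_cesaro_adapted (h : WhiteNoise F ξ V μ) {X : ℕ → Ω → ι → ℝ}
    (hX : ∀ n, Measurable[F n] (X n)) (hb : BddLp X 4 μ) :
    ∀ᵐ ω ∂μ, Tendsto (cesaro fun n => vecMulVec (X n ω) (ξ n ω)) atTop (𝓝 0) := by
  have key : ∀ a b, ∀ᵐ ω ∂μ,
      Tendsto (cesaro fun n => X n ω a * ξ n ω b) atTop (𝓝 0) := fun a b =>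
    ae_tendsto_cesaro_mul (Y := fun n ω => X n ω a) (ζ := fun n ω => ξ n ω b) h.mono h.le
      (fun n => (measurable_pi_apply a).comp (hX n)) (fun n => h.adapted_eval n b)
      (fun n => h.indep_eval n b) (fun n => h.mean n b) ((hb.eval a).mul (h.bdd.eval b))
  filter_upwards [ae_all_iff.2 fun a => ae_all_iff.2 fun b => key a b] with ω hω
  exact tendsto_cesaro_matrix_iff.2 hω

omit [IsProbabilityMeasure μ] in
theorem ae_tendsto_cesaro_lag (h : WhiteNoise F ξ V μ) (k : ℕ) :
    ∀ᵐ ω ∂μ, Tendsto (cesaro fun n => vecMulVec (ξ (n + (k + 1)) ω) (ξ n ω)) atTop (𝓝 0) := by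
  -- In the shifted filtration the later noise is still white and the earlier `ξ n` is an adapted
  -- process.
  have h' : WhiteNoise (fun n => F (n + (k + 1))) (fun n => ξ (n + (k + 1))) V μ :=
    { mono := fun i j hij => h.mono (by omega)
      le := fun n => h.le _
      adapted := fun n => by
        rw [add_right_comm]
        exact h.adapted (n + (k + 1))
      indep := fun n => h.indep _
      bdd := h.bdd.shift _
      mean := fun n => h.mean _
      cov := fun n => h.cov _ }
  filter_upwards [h'.ae_tendsto_cesaro_adapted (X := ξ)
    (fun n => (h.adapted n).mono (h.mono (by omega)) le_rfl) h.bdd] with ω hω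
  simpa using tendsto_cesaro_vecMulVec_swap hω

omit [IsProbabilityMeasure μ] in
theorem adapted_zeroState (h : WhiteNoise F ξ V μ) (M : Matrix ι ι ℝ) (H : Matrix ι ο ℝ) (n : ℕ) :
    Measurable[F n] fun ω => zeroState M (fun k => H *ᵥ ξ k ω) n := by
  refine Finset.measurable_fun_sum _ fun k hk => ?_
  have hk' := Finset.mem_range.1 hk
  have hm : Measurable fun x : ο → ℝ => M ^ k *ᵥ H *ᵥ x :=
    (show Continuous fun x : ο → ℝ => M ^ k *ᵥ H *ᵥ x by fun_prop).measurable
  exact hm.comp ((h.adapted (n - 1 - k)).mono (h.mono (by omega)) le_rfl)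

omit [IsProbabilityMeasure μ] in
-- Minkowski's inequality together with the summable bound on the powers of `M` gives a bound
-- uniform in `n`.
theorem bddLp_zeroState (h : WhiteNoise F ξ V μ) {M : Matrix ι ι ℝ} (hM : SchurStable M)
    (H : Matrix ι ο ℝ) : BddLp (fun n ω => zeroState M (fun k => H *ᵥ ξ k ω) n) 4 μ := by
  obtain ⟨C, hC, hξ⟩ := h.bdd
  obtain ⟨c, hc, hcM⟩ := hM.exists_summable_bound
  set g := ‖LinearMap.toContinuousLinearMap H.mulVecLin‖
  have hg : ∀ x, ‖H *ᵥ x‖ ≤ g * ‖x‖ := fun x =>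
    (LinearMap.toContinuousLinearMap H.mulVecLin).le_opNorm x
  refine ⟨(∑' k, ENNReal.ofReal (c k)) * (ENNReal.ofReal g * C),
    ENNReal.mul_ne_top hc.tsum_ofReal_ne_top (ENNReal.mul_ne_top ENNReal.ofReal_ne_top hC),
    fun n => ⟨((h.adapted_zeroState M H n).mono (h.le n) le_rfl).aestronglyMeasurable, ?_⟩⟩
  have hm : ∀ k j, AEStronglyMeasurable (fun ω => M ^ k *ᵥ H *ᵥ ξ j ω) μ := fun k j =>
    (show Continuous fun x : ο → ℝ => M ^ k *ᵥ H *ᵥ x by fun_prop).comp_aestronglyMeasurable (hξ j).1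
  have e : (fun ω => zeroState M (fun k => H *ᵥ ξ k ω) n)
      = ∑ k ∈ Finset.range n, fun ω => M ^ k *ᵥ H *ᵥ ξ (n - 1 - k) ω := by
    ext ω : 1
    simp [zeroState]
  dsimp only
  rw [e]
  calc _ ≤ ∑ k ∈ Finset.range n, eLpNorm (fun ω => M ^ k *ᵥ H *ᵥ ξ (n - 1 - k) ω) 4 μ :=
        eLpNorm_sum_le (fun k _ => hm _ _) (by norm_num)
    _ ≤ ∑ k ∈ Finset.range n, ENNReal.ofReal (c k) * (ENNReal.ofReal g * C) := by
        refine Finset.sum_le_sum fun k _ => ?_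
        calc _ ≤ ENNReal.ofReal (c k) * eLpNorm (fun ω => H *ᵥ ξ (n - 1 - k) ω) 4 μ :=
              eLpNorm_le_mul_eLpNorm_of_ae_le_mul (Eventually.of_forall fun ω => hcM k _) _
          _ ≤ ENNReal.ofReal (c k) * (ENNReal.ofReal g * eLpNorm (ξ (n - 1 - k)) 4 μ) := by
              gcongr
              exact eLpNorm_le_mul_eLpNorm_of_ae_le_mul (Eventually.of_forall fun ω => hg _) _
          _ ≤ _ := by
              gcongr
              exact (hξ _).2
    _ ≤ _ := by
        rw [← Finset.sum_mul]
        gcongr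
        exact ENNReal.sum_le_tsum _

/-- The sample covariance of the stationary regime. -/
theorem ae_tendsto_cesaro_zeroState (h : WhiteNoise F ξ V μ) {M : Matrix ι ι ℝ}
    (hM : SchurStable M) {H : Matrix ι ο ℝ} {T : Matrix ι ι ℝ}
    (hT : T = M * T * Mᵀ + H * V * Hᵀ) :
    ∀ᵐ ω ∂μ,
      Tendsto (cesaro fun n => vecMulVec (zeroState M (fun k => H *ᵥ ξ k ω) n)
        (zeroState M (fun k => H *ᵥ ξ k ω) n)) atTop (𝓝 T) := by
  have hb := h.bddLp_zeroState hM H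
  have hN := ae_all_iff.2 fun a => ae_all_iff.2 fun b =>
    ((hb.eval a).mul (hb.eval b)).ae_tendsto_inv_mul
  filter_upwards [h.ae_tendsto_cesaro_sq,
    h.ae_tendsto_cesaro_adapted (h.adapted_zeroState M H) hb, hN] with ω h1 h2 h3
  exact tendsto_cesaro_of_recursion hM hT (zeroState_succ M _) h1 h2
    (tendsto_pi_nhds.2 fun a => tendsto_pi_nhds.2 fun b => h3 a b)

omit [DecidableEq ι] in
theorem integrable_of_recursion (h : WhiteNoise F ξ V μ) {M : Matrix ι ι ℝ} {H : Matrix ι ο ℝ}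
    {X : ℕ → Ω → ι → ℝ} (hX : ∀ n ω, X (n + 1) ω = M *ᵥ X n ω + H *ᵥ ξ n ω)
    (hi0 : ∀ a, Integrable (fun ω => X 0 ω a) μ) (n : ℕ) :
    ∀ a, Integrable (fun ω => X n ω a) μ := by
  induction n with
  | zero => exact hi0
  | succ n ih =>
    intro a
    simp only [hX]
    exact (integrable_finsetSum _ fun c _ => (ih c).const_mul _).add
      (integrable_finsetSum _ fun c _ => (h.integrable n c).const_mul _)

theorem integral_of_recursion (h : WhiteNoise F ξ V μ) {M : Matrix ι ι ℝ} {H : Matrix ι ο ℝ}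
    {X : ℕ → Ω → ι → ℝ} (hX : ∀ n ω, X (n + 1) ω = M *ᵥ X n ω + H *ᵥ ξ n ω)
    (hi0 : ∀ a, Integrable (fun ω => X 0 ω a) μ) (n : ℕ) :
    (fun a => ∫ ω, X n ω a ∂μ) = M ^ n *ᵥ fun a => ∫ ω, X 0 ω a ∂μ := by
  induction n with
  | zero => simp
  | succ n ih =>
    rw [pow_succ', ← mulVec_mulVec, ← ih]
    ext a
    have i1 := fun c => (h.integrable_of_recursion hX hi0 n c).const_mul (M a c)
    have i2 := fun c => (h.integrable n c).const_mul (H a c)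
    have e : ∀ ω, X (n + 1) ω a = ∑ c, M a c * X n ω c + ∑ c, H a c * ξ n ω c :=
      fun ω => by rw [hX]; rfl
    simp only [e]
    rw [integral_add (integrable_finsetSum _ fun c _ => i1 c)
      (integrable_finsetSum _ fun c _ => i2 c), integral_finsetSum _ fun c _ => i1 c,
      integral_finsetSum _ fun c _ => i2 c]
    simp only [integral_const_mul, h.mean, mul_zero, Finset.sum_const_zero, add_zero]
    rfl

/-- Covariance of the state of a linear recursion with the past noise. -/
theorem integral_mul_of_recursion (h : WhiteNoise F ξ V μ)
    {M : Matrix ι ι ℝ} {H : Matrix ι ο ℝ} {X : ℕ → Ω → ι → ℝ}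
    (hX : ∀ n ω, X (n + 1) ω = M *ᵥ X n ω + H *ᵥ ξ n ω) (h0 : Measurable[F 0] (X 0))
    (hi0 : ∀ a, Integrable (fun ω => X 0 ω a) μ) (t k : ℕ) (a : ι) (b : ο) :
    Integrable (fun ω => X (t + k + 1) ω a * ξ t ω b) μ ∧
      ∫ ω, X (t + k + 1) ω a * ξ t ω b ∂μ = (M ^ k * (H * V)) a b := by
  have hXe : ∀ n ω a, X (n + 1) ω a = ∑ c, M a c * X n ω c + ∑ c, H a c * ξ n ω c :=
    fun n ω a => by rw [hX]; rfl
  have hXm : ∀ n, ∀ a, Measurable[F n] fun ω => X n ω a := fun n => by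
    induction n with
    | zero => exact fun a => (measurable_pi_apply a).comp h0
    | succ n ih =>
      intro a
      simp only [hXe]
      exact (Finset.measurable_fun_sum _ fun c _ =>
        ((ih c).mono (h.mono n.le_succ) le_rfl).const_mul _).add
        (Finset.measurable_fun_sum _ fun c _ => (h.adapted_eval n c).const_mul _)
  have hXi := h.integrable_of_recursion hX hi0
  have hstep : ∀ j (U : Matrix ι ο ℝ) (V' : Matrix ο ο ℝ),
      (∀ a b, Integrable (fun ω => X (t + j) ω a * ξ t ω b) μ ∧
        ∫ ω, X (t + j) ω a * ξ t ω b ∂μ = U a b) →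
      (∀ a b, ∫ ω, ξ (t + j) ω a * ξ t ω b ∂μ = V' a b) →
      ∀ a b, Integrable (fun ω => X (t + j + 1) ω a * ξ t ω b) μ ∧
        ∫ ω, X (t + j + 1) ω a * ξ t ω b ∂μ = (M * U + H * V') a b := by
    intro j U V' hU hV' a b
    have i1 : ∀ c, Integrable (fun ω => M a c * (X (t + j) ω c * ξ t ω b)) μ :=
      fun c => (hU c b).1.const_mul _
    have i2 : ∀ c, Integrable (fun ω => H a c * (ξ (t + j) ω c * ξ t ω b)) μ :=
      fun c => (h.integrable_mul _ _ c b).const_mul _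
    have i3 := integrable_finsetSum Finset.univ fun c _ => i1 c
    have i4 := integrable_finsetSum Finset.univ fun c _ => i2 c
    simp only [hXe, add_mul, Finset.sum_mul, mul_assoc]
    refine ⟨i3.add i4, ?_⟩
    rw [integral_add i3 i4, integral_finsetSum _ fun c _ => i1 c,
      integral_finsetSum _ fun c _ => i2 c]
    simp only [integral_const_mul, (hU _ _).2, hV']
    rfl
  induction k generalizing a b with
  | zero =>
    have := hstep 0 0 V (fun a b => ⟨?_, ?_⟩) (fun a b => h.cov t a b) a b
    · simpa using this
    -- Integrability of the product rests on independence, since the state inherits only first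
    -- moments from `X 0`.
    · have hi : IndepFun (X t · a) (ξ t · b) μ :=
        indep_of_indep_of_le_left (h.indep_eval t b) (hXm t a).comap_le
      exact hi.integrable_mul (hXi t a) (h.integrable t b)
    · exact integral_mul_eq_zero_of_indep (h.le t) (hXm t a) (h.measurable_eval t b)
        (h.indep_eval t b) (h.mean t b)
  | succ k ih =>
    have := hstep (k + 1) _ 0 ih (fun a b => ?_) a b
    · simpa [pow_succ', Matrix.mul_assoc] using this
    · have := integral_mul_eq_zero_of_indep (h.le _)
        ((h.adapted_eval t b).mono (h.mono (show t + 1 ≤ t + (k + 1) by omega)) le_rfl)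
        (h.measurable_eval _ a) (h.indep_eval (t + (k + 1)) a) (h.mean _ a)
      simpa [mul_comm] using this

end WhiteNoise

/-! ### The stacked noise and the error recursion. -/

section Stacking

variable {κ p : ℕ} {m q : Fin κ → ℕ}

/-- Coordinates of the stacked noise `(w, z_1, …, z_κ, e_1, …, e_κ)`. -/
abbrev NoiseIdx (p : ℕ) (m q : Fin κ → ℕ) : Type :=
  Fin p ⊕ ((Σ j, Fin (m j)) ⊕ (Σ i, Fin (q i)))

/-- The stacked noise at time `n`. -/
def Signals.noise (S : Signals κ p m q) (n : ℕ) : NoiseIdx p m q → ℝ :=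
  Sum.elim (S.w n) (Sum.elim (fun s => S.z s.1 n s.2) fun s => S.e s.1 n s.2)

namespace Plant

/-- The covariance of the stacked noise. -/
def noiseCov (P : Plant κ p m q) : Matrix (NoiseIdx p m q) (NoiseIdx p m q) ℝ :=
  fromBlocks P.covW 0 0 (fromBlocks (blockDiagonal' P.covZ) 0 0 (blockDiagonal' P.covE))

/-- The matrix through which the stacked noise enters the error dynamics. -/
def noiseIn (P : Plant κ p m q) : Matrix (Fin κ × Fin p) (NoiseIdx p m q) ℝ :=
  fromCols (Matrix.of fun a b => -(1 : Matrix (Fin p) (Fin p) ℝ) a.2 b)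
    (fromCols (Matrix.of fun a s => -P.L s.1 a.2 s.2) (Matrix.of fun a s => P.errB s.1 a s.2))

end Plant

theorem of_sigma_mul_blockDiagonal' {α o : Type*} [Fintype o] [DecidableEq o] {n : o → Type*}
    [∀ i, Fintype (n i)] (B : ∀ i, Matrix α (n i) ℝ) (V : ∀ i, Matrix (n i) (n i) ℝ) :
    (Matrix.of fun a (s : Σ i, n i) => B s.1 a s.2) * blockDiagonal' V
      = Matrix.of fun a s => (B s.1 * V s.1) a s.2 := by
  ext a ⟨i, b⟩
  simp only [mul_apply, of_apply, Fintype.sum_sigma]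
  rw [Finset.sum_eq_single i (fun j _ hj => ?_) (by simp)]
  · simp only [blockDiagonal'_apply_eq]
  · simp only [blockDiagonal'_apply_ne _ _ _ hj, mul_zero, Finset.sum_const_zero]

theorem of_sigma_mul_blockDiagonal'_mul_transpose {α o : Type*} [Fintype o] [DecidableEq o]
    {n : o → Type*} [∀ i, Fintype (n i)] (B : ∀ i, Matrix α (n i) ℝ)
    (V : ∀ i, Matrix (n i) (n i) ℝ) :
    (Matrix.of fun a (s : Σ i, n i) => B s.1 a s.2) * blockDiagonal' V
      * (Matrix.of fun a (s : Σ i, n i) => B s.1 a s.2)ᵀ = ∑ i, B i * V i * (B i)ᵀ := by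
  rw [of_sigma_mul_blockDiagonal']
  ext a b
  simp only [Matrix.sum_apply]
  simp [mul_apply, Fintype.sum_sigma]

namespace Plant

theorem noiseIn_mul_noiseCov (P : Plant κ p m q) : P.noiseIn * P.noiseCov
    = fromCols (Matrix.of fun a b => -P.covW a.2 b)
      (fromCols (Matrix.of fun a s => -(P.L s.1 * P.covZ s.1) a.2 s.2)
        (Matrix.of fun a s => (P.errB s.1 * P.covE s.1) a s.2)) := by
  have hW : (Matrix.of fun (a : Fin κ × Fin p) b => -(1 : Matrix (Fin p) (Fin p) ℝ) a.2 b) * P.covW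
      = Matrix.of fun a b => -P.covW a.2 b := by
    ext a b
    simp [mul_apply, Matrix.one_apply]
  have hZ := of_sigma_mul_blockDiagonal'
    (fun j => Matrix.of fun (a : Fin κ × Fin p) s => -P.L j a.2 s) P.covZ
  have hE := of_sigma_mul_blockDiagonal' P.errB P.covE
  simp only [of_apply] at hZ
  rw [noiseIn, noiseCov, fromCols_mul_fromBlocks, fromCols_mul_fromBlocks, hW, hZ, hE]
  simp only [Matrix.mul_zero, add_zero, zero_add]
  congr 2
  ext a s
  simp [mul_apply]

/-- Process and measurement noise enter every block identically, which produces the all-ones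
Kronecker factor; their minus signs cancel in the congruence. -/
theorem errCov_eq (P : Plant κ p m q) : P.errCov = P.noiseIn * P.noiseCov * P.noiseInᵀ := by
  rw [noiseIn_mul_noiseCov, noiseIn, transpose_fromCols, transpose_fromCols, fromCols_mul_fromRows,
    fromCols_mul_fromRows, ← of_sigma_mul_blockDiagonal', of_sigma_mul_blockDiagonal'_mul_transpose,
    errCov, ← add_assoc, add_comm]
  congr 1
  ext a b
  simp only [kroneckerMap_apply, of_apply, one_mul, Matrix.add_apply, Matrix.sum_apply]
  congr 1
  · simp [mul_apply, Matrix.one_apply]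
  · simp [mul_apply, Fintype.sum_sigma]

theorem errA_mulVec' (P : Plant κ p m q) (v : Fin κ × Fin p → ℝ) (i : Fin κ) :
    (fun a => (P.errA *ᵥ v) (i, a)) = (P.A + P.BK + P.LC) *ᵥ (fun b => v (i, b))
      - ∑ l, (P.B l * P.K l) *ᵥ fun b => v (l, b) :=
  funext fun a => P.errA_mulVec v i a

theorem noiseIn_mulVec (P : Plant κ p m q) (S : Signals κ p m q) (n : ℕ) (i : Fin κ) :
    (fun a => (P.noiseIn *ᵥ S.noise n) (i, a))
      = P.B i *ᵥ S.e i n - ∑ l, P.B l *ᵥ S.e l n - S.w n - ∑ j, P.L j *ᵥ S.z j n := by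
  ext a
  have h1 : ∑ l, ∑ b, (if i = l then P.B l a b * S.e l n b else 0)
      = ∑ b, P.B i a b * S.e i n b := by
    rw [Finset.sum_eq_single i (fun l _ hl => by simp [Ne.symm hl]) (by simp)]
    simp
  simp only [noiseIn, Signals.noise, fromCols_mulVec, Sum.elim_comp_inl, Sum.elim_comp_inr]
  simp only [Pi.add_apply, Pi.sub_apply, Finset.sum_apply, mulVec, dotProduct, of_apply, errB,
    Fintype.sum_sigma, sub_mul, Finset.sum_sub_distrib, h1, neg_mul, Finset.sum_neg_distrib,
    Matrix.one_apply, ite_mul, one_mul, zero_mul, Finset.sum_ite_eq, Finset.mem_univ, if_true]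
  ring

/-- Without attacks, the observer errors follow a linear recursion driven by the noise. -/
theorem Delta_succ (P : Plant κ p m q) {S : Signals κ p m q} (hv : ∀ i n, S.v i n = 0)
    (hν : ∀ i j n, S.ν i j n = 0) (n : ℕ) :
    P.Delta S (n + 1) = P.errA *ᵥ P.Delta S n + P.noiseIn *ᵥ S.noise n := by
  have key : ∀ i, P.xhat S i (n + 1) - P.x S (n + 1)
      = (fun a => (P.errA *ᵥ P.Delta S n) (i, a)) + fun a => (P.noiseIn *ᵥ S.noise n) (i, a) := by
    intro i
    rw [errA_mulVec', noiseIn_mulVec]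
    have hD : ∀ l, (fun b => P.Delta S n (l, b)) = P.xhat S l n - P.x S n := fun l => rfl
    have hx : P.x S (n + 1) = P.A *ᵥ P.x S n
        + ∑ l, P.B l *ᵥ (P.K l *ᵥ P.xhat S l n + S.e l n) + S.w n := rfl
    have hxh : P.xhat S i (n + 1) = (P.A + P.BK + P.LC) *ᵥ P.xhat S i n
        - ∑ j, P.L j *ᵥ P.recv S (P.x S n) i j n + P.B i *ᵥ S.e i n := rfl
    -- Adding and subtracting `BK x` completes both `x̂_i` and the feedback terms to errors.
    have hBK : P.BK *ᵥ P.x S n = ∑ l, (P.B l * P.K l) *ᵥ P.x S n := by rw [BK, sum_mulVec]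
    have hLC : P.LC *ᵥ P.x S n = ∑ l, (P.L l * P.C l) *ᵥ P.x S n := by rw [LC, sum_mulVec]
    rw [hx, hxh]
    simp only [hD, recv, meas, hv, hν, add_zero, mulVec_add, mulVec_sub, mulVec_mulVec,
      Finset.sum_add_distrib, Finset.sum_sub_distrib, ← hBK, ← hLC, add_mulVec]
    abel
  ext ⟨i, a⟩
  exact congrFun (key i) a

end Plant

end Stacking

/-! ### The filtration generated by the sources. -/

section Past

variable {Ω : Type*} {κ p : ℕ} {m q : Fin κ → ℕ}

/-- The sources that are revealed before time `n`. -/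
def Source.Before (n : ℕ) : Source κ → Prop
  | .init => True
  | .process k => k < n
  | .meas _ k => k < n
  | .excite _ k => k < n

/-- The information revealed before time `n`. -/
abbrev past (S : Ω → Signals κ p m q) (n : ℕ) : MeasurableSpace Ω :=
  ⨆ s ∈ {s : Source κ | s.Before n}, sourceAlg S s

theorem sourceAlg_le_past (S : Ω → Signals κ p m q) {n : ℕ} {s : Source κ} (h : s.Before n) :
    sourceAlg S s ≤ past S n :=
  le_iSup₂ (f := fun s (_ : s ∈ {s : Source κ | s.Before n}) => sourceAlg S s) s h

theorem past_mono (S : Ω → Signals κ p m q) : Monotone (past S) := by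
  intro n k hnk
  refine iSup₂_le fun s hs => sourceAlg_le_past S ?_
  cases s with
  | init => trivial
  | _ => exact lt_of_lt_of_le (by simpa [Source.Before] using hs) hnk

/-- The source of each coordinate of the stacked noise. -/
def NoiseIdx.source (n : ℕ) : NoiseIdx p m q → Source κ
  | .inl _ => .process n
  | .inr (.inl s) => .meas s.1 n
  | .inr (.inr s) => .excite s.1 n

theorem measurable_noise_eval (S : Ω → Signals κ p m q) (n : ℕ) (a : NoiseIdx p m q) :
    Measurable[sourceAlg S (NoiseIdx.source n a)] fun ω => (S ω).noise n a := by
  rcases a with a | ⟨j, a⟩ | ⟨i, a⟩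
  · exact (measurable_pi_apply a).comp (comap_measurable _)
  · exact (measurable_pi_apply a).comp (comap_measurable _)
  · exact (measurable_pi_apply a).comp (comap_measurable _)

theorem measurable_of_eval {ι : Type*} {F : MeasurableSpace Ω} {f : Ω → ι → ℝ}
    (h : ∀ a, Measurable[F] fun ω => f ω a) : Measurable[F] f :=
  measurable_pi_lambda f h

end Past

/-! ### The stochastic model supplies white noise. -/

section Noise

variable {Ω : Type*} [mΩ : MeasurableSpace Ω] {μ : Measure Ω}

theorem BddLp.of_eval {ι : Type*} [Fintype ι] {f : ℕ → Ω → ι → ℝ} {r : ENNReal} (hr : 1 ≤ r)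
    (h : ∀ a, BddLp (fun n ω => f n ω a) r μ) : BddLp f r μ := by
  choose C hC h using h
  refine ⟨∑ a, C a, ENNReal.sum_ne_top.2 fun a _ => hC a, fun n =>
    ⟨(aemeasurable_pi_lambda _ fun a => (h a n).1.aemeasurable).aestronglyMeasurable, ?_⟩⟩
  calc eLpNorm (f n) r μ ≤ eLpNorm (∑ a, fun ω => ‖f n ω a‖) r μ := by
        refine eLpNorm_mono_real fun ω => ?_
        rw [Finset.sum_apply]
        refine (pi_norm_le_iff_of_nonneg (Finset.sum_nonneg fun a _ => norm_nonneg _)).2 fun a => ?_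
        exact Finset.single_le_sum (f := fun a => ‖f n ω a‖) (fun a _ => norm_nonneg _)
          (Finset.mem_univ a)
    _ ≤ ∑ a, eLpNorm (fun ω => ‖f n ω a‖) r μ := eLpNorm_sum_le (fun a _ => (h a n).1.norm) hr
    _ ≤ ∑ a, C a := Finset.sum_le_sum fun a _ => by
        rw [eLpNorm_norm]
        exact (h a n).2

/-- The norm depends on `V a a` alone, so moment bounds are uniform in time. -/
theorem IsCenteredGaussian.eLpNorm_eval {d : ℕ} {X : Ω → Fin d → ℝ} {V : Matrix (Fin d) (Fin d) ℝ}
    (h : IsCenteredGaussian X V μ) (a : Fin d) (r : ENNReal) :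
    eLpNorm (fun ω => X ω a) r μ = eLpNorm id r (gaussianReal 0 (V a a).toNNReal) := by
  have hg : HasGaussianLaw (fun ω => X ω a) μ := h.gaussian.eval a
  have hm := hg.map_eq_gaussianReal
  rw [h.mean, ← covariance_self hg.aemeasurable, h.cov] at hm
  rw [← hm, eLpNorm_map_measure aestronglyMeasurable_id hg.aemeasurable]
  rfl

theorem bddLp_of_isCenteredGaussian {d : ℕ} {X : ℕ → Ω → Fin d → ℝ} {V : Matrix (Fin d) (Fin d) ℝ}
    (h : ∀ n, IsCenteredGaussian (X n) V μ) (a : Fin d) {r : ENNReal} (hr : r ≠ ⊤) :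
    BddLp (fun n ω => X n ω a) r μ :=
  ⟨_, (memLp_id_gaussianReal' r hr).2.ne, fun n =>
    ⟨((h n).gaussian.eval a).aemeasurable.aestronglyMeasurable, ((h n).eLpNorm_eval a r).le⟩⟩

theorem IsCenteredGaussian.integral_mul {d : ℕ} {X : Ω → Fin d → ℝ} {V : Matrix (Fin d) (Fin d) ℝ}
    (h : IsCenteredGaussian X V μ) (a b : Fin d) : ∫ ω, X ω a * X ω b ∂μ = V a b := by
  rw [← h.cov a b, covariance, h.mean, h.mean]
  simp

variable {κ p : ℕ} {m q : Fin κ → ℕ}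

namespace NoiseModel

variable {P : Plant κ p m q} {S : Ω → Signals κ p m q}

theorem sourceAlg_le (hS : NoiseModel P S μ) (s : Source κ) : sourceAlg S s ≤ mΩ := by
  cases s with
  | init => exact hS.measurable_init.comap_le
  | process n => exact (hS.process n).measurable.comap_le
  | meas i n => exact (hS.meas i n).measurable.comap_le
  | excite i n => exact (hS.excite i n).measurable.comap_le

theorem integral_noise (hS : NoiseModel P S μ) (n : ℕ) (a : NoiseIdx p m q) :
    ∫ ω, (S ω).noise n a ∂μ = 0 := by
  rcases a with a | ⟨j, a⟩ | ⟨i, a⟩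
  · exact (hS.process n).mean a
  · exact (hS.meas j n).mean a
  · exact (hS.excite i n).mean a

theorem integral_noise_mul_of_ne (hS : NoiseModel P S μ) (n : ℕ) {a b : NoiseIdx p m q}
    (hab : NoiseIdx.source n a ≠ NoiseIdx.source n b) :
    ∫ ω, (S ω).noise n a * (S ω).noise n b ∂μ = 0 :=
  integral_mul_eq_zero_of_indep (hS.sourceAlg_le _) (measurable_noise_eval S n a)
    ((measurable_noise_eval S n b).mono (hS.sourceAlg_le _) le_rfl)
    (indep_of_indep_of_le_right (hS.indep.indep hab) (measurable_noise_eval S n b).comap_le)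
    (hS.integral_noise n b)

theorem integral_noise_mul (hS : NoiseModel P S μ) (n : ℕ) (a b : NoiseIdx p m q) :
    ∫ ω, (S ω).noise n a * (S ω).noise n b ∂μ = P.noiseCov a b := by
  by_cases hab : NoiseIdx.source n a = NoiseIdx.source n b
  · rcases a with a | ⟨j, a⟩ | ⟨i, a⟩ <;> rcases b with b | ⟨j', b⟩ | ⟨i', b⟩ <;>
      simp only [NoiseIdx.source, reduceCtorEq, Source.meas.injEq, Source.excite.injEq,
        and_true] at hab
    · exact (hS.process n).integral_mul a b
    · subst hab
      simpa [Signals.noise, Plant.noiseCov, blockDiagonal'_apply_eq] using (hS.meas j n).integral_mul a b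
    · subst hab
      simpa [Signals.noise, Plant.noiseCov, blockDiagonal'_apply_eq] using (hS.excite i n).integral_mul a b
  · rw [hS.integral_noise_mul_of_ne n hab]
    rcases a with a | ⟨j, a⟩ | ⟨i, a⟩ <;> rcases b with b | ⟨j', b⟩ | ⟨i', b⟩ <;>
      simp only [NoiseIdx.source, Source.meas.injEq, Source.excite.injEq, and_true,
        not_true_eq_false] at hab <;>
      simp only [Plant.noiseCov, fromBlocks_apply₁₁, fromBlocks_apply₁₂, fromBlocks_apply₂₁,
        fromBlocks_apply₂₂, Matrix.zero_apply]
    · exact (blockDiagonal'_apply_ne _ _ _ hab).symm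
    · exact (blockDiagonal'_apply_ne _ _ _ hab).symm

theorem whiteNoise (hS : NoiseModel P S μ) :
    WhiteNoise (past S) (fun n ω => (S ω).noise n) P.noiseCov μ where
  mono := past_mono S
  le n := iSup₂_le fun s _ => hS.sourceAlg_le s
  adapted n := by
    refine measurable_of_eval fun a => (measurable_noise_eval S n a).mono ?_ le_rfl
    refine sourceAlg_le_past S ?_
    rcases a with a | ⟨j, a⟩ | ⟨i, a⟩ <;> exact n.lt_succ_self
  indep n := by
    -- The noise at time `n` uses only sources not yet revealed; disjoint groups of independent
    -- sources generate independent σ-algebras.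
    have hd : Disjoint {s : Source κ | s.Before n}
        (Set.range (NoiseIdx.source n : NoiseIdx p m q → Source κ)) := by
      rw [Set.disjoint_right]
      rintro _ ⟨a, rfl⟩ h
      rcases a with a | ⟨j, a⟩ | ⟨i, a⟩ <;> exact lt_irrefl n h
    refine indep_of_indep_of_le_right (indep_iSup_of_disjoint hS.sourceAlg_le hS.indep hd) ?_
    refine Measurable.comap_le (measurable_of_eval fun a =>
      (measurable_noise_eval S n a).mono ?_ le_rfl)
    exact le_iSup₂ (f := fun s (_ : s ∈ Set.range (NoiseIdx.source n : NoiseIdx p m q → Source κ))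
      => sourceAlg S s) _ ⟨a, rfl⟩
  bdd := by
    refine BddLp.of_eval (by norm_num) fun a => ?_
    rcases a with a | ⟨j, a⟩ | ⟨i, a⟩
    · exact bddLp_of_isCenteredGaussian hS.process a (by norm_num)
    · exact bddLp_of_isCenteredGaussian (hS.meas j) a (by norm_num)
    · exact bddLp_of_isCenteredGaussian (hS.excite i) a (by norm_num)
  mean := hS.integral_noise
  cov := hS.integral_noise_mul

omit mΩ in
theorem measurable_Delta_zero (P : Plant κ p m q) (S : Ω → Signals κ p m q) :
    Measurable[past S 0] fun ω => P.Delta (S ω) 0 := by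
  have h : Measurable[sourceAlg S .init] fun ω => P.Delta (S ω) 0 := by
    refine Measurable.comp (g := fun x : (Fin p → ℝ) × (Fin κ → Fin p → ℝ) =>
      fun a : Fin κ × Fin p => x.2 a.1 a.2 - x.1 a.2) ?_ (comap_measurable _)
    fun_prop
  exact h.mono (sourceAlg_le_past S trivial) le_rfl

theorem integrable_Delta_zero (hS : NoiseModel P S μ) (a : Fin κ × Fin p) :
    Integrable (fun ω => P.Delta (S ω) 0 a) μ :=
  ((hS.integrable_xhat0 a.1).eval a.2).sub (hS.integrable_x0.eval a.2)

end NoiseModel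

end Noise

/-! ### Averages of the lagged noise stacked on the residual. -/

section Residual

variable {ι ο α β : Type*} [Fintype ι] [Fintype ο]

theorem tendsto_cesaro_vecMulVec_elim {x : ℕ → ι → ℝ} {ξ : ℕ → ο → ℝ} {V : Matrix ο ο ℝ}
    {T : Matrix ι ι ℝ} {U : Matrix ι ο ℝ} (K : ℕ)
    (hξ : Tendsto (cesaro fun n => vecMulVec (ξ n) (ξ n)) atTop (𝓝 V))
    (hxξ : Tendsto (cesaro fun n => vecMulVec (x n) (ξ n)) atTop (𝓝 0))
    (hx : Tendsto (cesaro fun n => vecMulVec (x n) (x n)) atTop (𝓝 T))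
    (hξK : Tendsto (cesaro fun n => vecMulVec (ξ (n + K)) (ξ n)) atTop (𝓝 0))
    (hxK : Tendsto (cesaro fun n => vecMulVec (x (n + K)) (ξ n)) atTop (𝓝 U))
    (E : Matrix α ο ℝ) (C : Matrix β ι ℝ) (Z : Matrix β ο ℝ) :
    Tendsto (cesaro fun n => vecMulVec
        (Sum.elim (E *ᵥ ξ n) (C *ᵥ x (n + K) - Z *ᵥ ξ (n + K)))
        (Sum.elim (E *ᵥ ξ n) (C *ᵥ x (n + K) - Z *ᵥ ξ (n + K)))) atTop
      (𝓝 (fromBlocks (E * V * Eᵀ) (C * U * Eᵀ)ᵀ (C * U * Eᵀ) (C * T * Cᵀ + Z * V * Zᵀ))) := by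
  have hee := tendsto_cesaro_vecMulVec_mulVec E E hξ
  have hre : Tendsto (cesaro fun n => vecMulVec (C *ᵥ x (n + K) - Z *ᵥ ξ (n + K)) (E *ᵥ ξ n))
      atTop (𝓝 (C * U * Eᵀ)) := by
    have h := (tendsto_cesaro_vecMulVec_mulVec C E hxK).sub
      (tendsto_cesaro_vecMulVec_mulVec Z E hξK)
    simp only [Matrix.mul_zero, Matrix.zero_mul, sub_zero] at h
    refine h.congr fun N => ?_
    rw [← cesaro_sub]
    simp only [sub_vecMulVec]
  have hrr : Tendsto (cesaro fun n => vecMulVec (C *ᵥ x (n + K) - Z *ᵥ ξ (n + K))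
      (C *ᵥ x (n + K) - Z *ᵥ ξ (n + K))) atTop (𝓝 (C * T * Cᵀ + Z * V * Zᵀ)) := by
    -- Both factors of this block carry the same time index, so the shift can be dropped.
    rw [tendsto_cesaro_add_iff K
      (f := fun n => vecMulVec (C *ᵥ x n - Z *ᵥ ξ n) (C *ᵥ x n - Z *ᵥ ξ n))]
    have h := ((tendsto_cesaro_vecMulVec_mulVec C C hx).sub
      (tendsto_cesaro_vecMulVec_mulVec C Z hxξ)).sub
      ((tendsto_cesaro_vecMulVec_mulVec Z C (tendsto_cesaro_vecMulVec_swap hxξ)).sub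
      (tendsto_cesaro_vecMulVec_mulVec Z Z hξ))
    simp only [transpose_zero, Matrix.mul_zero, Matrix.zero_mul, sub_zero, zero_sub,
      sub_neg_eq_add] at h
    refine h.congr fun N => ?_
    rw [← cesaro_sub, ← cesaro_sub, ← cesaro_sub]
    simp only [sub_vecMulVec, vecMulVec_sub]
    congr 1
    ext n : 1
    abel
  have her := tendsto_cesaro_vecMulVec_swap hre
  rw [tendsto_cesaro_matrix_iff] at *
  rintro (a | a) (b | b)
  · exact hee a b
  · exact her a b
  · exact hre a b
  · exact hrr a b

end Residual

/-! ### Limits and means of `ψ`. -/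

section Main

variable {κ p : ℕ} {m q : Fin κ → ℕ}

namespace Plant

/-- The coordinates of the excitation of subcontroller `i` in the stacked noise. -/
def selE (p : ℕ) (m q : Fin κ → ℕ) (i : Fin κ) : Matrix (Fin (q i)) (NoiseIdx p m q) ℝ :=
  (1 : Matrix (NoiseIdx p m q) (NoiseIdx p m q) ℝ).submatrix (fun a => .inr (.inr ⟨i, a⟩)) id

/-- The coordinates of the measurement noise of subcontroller `j` in the stacked noise. -/
def selZ (p : ℕ) (m q : Fin κ → ℕ) (j : Fin κ) : Matrix (Fin (m j)) (NoiseIdx p m q) ℝ :=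
  (1 : Matrix (NoiseIdx p m q) (NoiseIdx p m q) ℝ).submatrix (fun a => .inr (.inl ⟨j, a⟩)) id

/-- The `i`-th block of the stacked observer errors. -/
def selBlock (κ p : ℕ) (i : Fin κ) : Matrix (Fin p) (Fin κ × Fin p) ℝ :=
  (1 : Matrix (Fin κ × Fin p) (Fin κ × Fin p) ℝ).submatrix (fun a => (i, a)) id

end Plant

open Plant

theorem one_submatrix_mulVec {n l : Type*} [Fintype n] [DecidableEq n] (f : l → n) (v : n → ℝ) :
    (1 : Matrix n n ℝ).submatrix f id *ᵥ v = v ∘ f := by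
  ext a
  simp [mulVec, dotProduct, Matrix.one_apply]

theorem one_submatrix_mul_left {n l o : Type*} [Fintype n] [DecidableEq n] (f : l → n)
    (X : Matrix n o ℝ) : (1 : Matrix n n ℝ).submatrix f id * X = X.submatrix f id := by
  ext a b
  simp [mul_apply, Matrix.one_apply]

theorem mul_one_submatrix_transpose {n l o : Type*} [Fintype n] [DecidableEq n] (f : l → n)
    (X : Matrix o n ℝ) : X * ((1 : Matrix n n ℝ).submatrix f id)ᵀ = X.submatrix id f := by
  ext a b
  simp [mul_apply, Matrix.one_apply]

namespace Plant

theorem noiseIn_mul_noiseCov_selE (P : Plant κ p m q) (i : Fin κ) :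
    P.noiseIn * P.noiseCov * (selE p m q i)ᵀ = P.errB i * P.covE i := by
  rw [selE, mul_one_submatrix_transpose, noiseIn_mul_noiseCov]
  rfl

/-- Brings `R` to the shape delivered by `tendsto_cesaro_vecMulVec_elim`, with selection matrices
extracting the blocks. -/
theorem R_eq (P : Plant κ p m q) (T : Matrix (Fin κ × Fin p) (Fin κ × Fin p) ℝ) (i j : Fin κ)
    (k : ℕ) :
    P.R T i j k = fromBlocks (selE p m q i * P.noiseCov * (selE p m q i)ᵀ)
      ((P.C j * selBlock κ p i) * (P.errA ^ k * (P.noiseIn * P.noiseCov)) * (selE p m q i)ᵀ)ᵀ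
      ((P.C j * selBlock κ p i) * (P.errA ^ k * (P.noiseIn * P.noiseCov)) * (selE p m q i)ᵀ)
      ((P.C j * selBlock κ p i) * T * (P.C j * selBlock κ p i)ᵀ
        + selZ p m q j * P.noiseCov * (selZ p m q j)ᵀ) := by
  have hE : selE p m q i * P.noiseCov * (selE p m q i)ᵀ = P.covE i := by
    rw [selE, mul_one_submatrix_transpose, one_submatrix_mul_left]
    ext a b
    simp [noiseCov, blockDiagonal'_apply_eq]
  have hZ : selZ p m q j * P.noiseCov * (selZ p m q j)ᵀ = P.covZ j := by
    rw [selZ, mul_one_submatrix_transpose, one_submatrix_mul_left]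
    ext a b
    simp [noiseCov, blockDiagonal'_apply_eq]
  have hQ : (P.C j * selBlock κ p i) * (P.errA ^ k * (P.noiseIn * P.noiseCov)) * (selE p m q i)ᵀ
      = P.C j * P.Q i k := by
    rw [Matrix.mul_assoc, Matrix.mul_assoc (P.errA ^ k), noiseIn_mul_noiseCov_selE,
      Matrix.mul_assoc, selBlock, one_submatrix_mul_left]
    rfl
  have hT : (P.C j * selBlock κ p i) * T * (P.C j * selBlock κ p i)ᵀ
      = P.C j * diagBlock T i * (P.C j)ᵀ := by
    rw [transpose_mul, ← Matrix.mul_assoc, Matrix.mul_assoc (P.C j), Matrix.mul_assoc (P.C j),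
      selBlock, one_submatrix_mul_left, mul_one_submatrix_transpose]
    rfl
  rw [hE, hZ, hQ, hT, transpose_mul, R]

/-- Without attacks, the residual `C_j x̂_i - s_{i,j}` in terms of the error and the noise. -/
theorem residual_eq (P : Plant κ p m q) {S : Signals κ p m q} (hv : ∀ i n, S.v i n = 0)
    (hν : ∀ i j n, S.ν i j n = 0) (i j : Fin κ) (n : ℕ) :
    P.C j *ᵥ P.xhat S i n - P.s S i j n
      = (P.C j * selBlock κ p i) *ᵥ P.Delta S n - selZ p m q j *ᵥ S.noise n := by
  have h1 : selBlock κ p i *ᵥ P.Delta S n = P.xhat S i n - P.x S n := by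
    rw [selBlock, one_submatrix_mulVec]
    rfl
  have h2 : selZ p m q j *ᵥ S.noise n = S.z j n := by
    rw [selZ, one_submatrix_mulVec]
    rfl
  rw [← mulVec_mulVec, h1, h2, s, recv, meas, hv, hν, mulVec_sub]
  abel

theorem selE_mulVec_noise (S : Signals κ p m q) (i : Fin κ) (n : ℕ) :
    selE p m q i *ᵥ S.noise n = S.e i n := by
  rw [selE, one_submatrix_mulVec]
  rfl

end Plant

namespace NoiseModel

variable {Ω : Type*} [MeasurableSpace Ω] {μ : Measure Ω} [IsProbabilityMeasure μ]
  {P : Plant κ p m q} {S : Ω → Signals κ p m q}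

theorem ae_tendsto_cesaro_psi (hS : NoiseModel P S μ) (hA : SchurStable P.errA)
    (hv : ∀ ω i n, (S ω).v i n = 0) (hν : ∀ ω i j n, (S ω).ν i j n = 0)
    {T : Matrix (Fin κ × Fin p) (Fin κ × Fin p) ℝ} (hT : T = P.errA * T * P.errAᵀ + P.errCov)
    (i j : Fin κ) (k : ℕ) :
    ∀ᵐ ω ∂μ, Tendsto (cesaro fun n => vecMulVec (P.psi (S ω) i j k n) (P.psi (S ω) i j k n))
      atTop (𝓝 (P.R T i j k)) := by
  have hw := hS.whiteNoise
  rw [P.errCov_eq] at hT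
  filter_upwards [hw.ae_tendsto_cesaro_sq,
    hw.ae_tendsto_cesaro_adapted (hw.adapted_zeroState P.errA P.noiseIn)
      (hw.bddLp_zeroState hA P.noiseIn),
    hw.ae_tendsto_cesaro_zeroState hA hT, ae_all_iff.2 hw.ae_tendsto_cesaro_lag] with ω h1 h2 h3 h4
  have h5 := tendsto_cesaro_lag_of_recursion (zeroState_succ P.errA _) h1 h4 h2 k
  have h6 := tendsto_cesaro_vecMulVec_elim (k + 1) h1 h2 h3 (h4 k) h5 (selE p m q i)
    (P.C j * selBlock κ p i) (selZ p m q j)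
  rw [← P.R_eq T i j k] at h6
  -- The contribution of the initial error to `ψ`; it affects only the residual component.
  have hr : Tendsto (fun n => Sum.elim (0 : Fin (q i) → ℝ)
      ((P.C j * selBlock κ p i) *ᵥ (P.errA ^ (n + (k + 1)) *ᵥ P.Delta (S ω) 0))) atTop (𝓝 0) := by
    have hc : Continuous fun x : Fin κ × Fin p → ℝ => (P.C j * selBlock κ p i) *ᵥ x := by fun_prop
    have h7 := (hc.tendsto' 0 0 (mulVec_zero _)).comp
      ((hA.tendsto_pow_mulVec (P.Delta (S ω) 0)).comp (tendsto_add_atTop_nat (k + 1)))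
    refine tendsto_pi_nhds.2 ?_
    rintro (a | a)
    · exact tendsto_const_nhds
    · exact tendsto_pi_nhds.1 h7 a
  -- Starting at time `k + 1` skips exactly the indices at which the lagged excitation is set to
  -- zero.
  rw [← tendsto_cesaro_add_iff (k + 1)]
  refine (tendsto_cesaro_vecMulVec_perturb h6 hr).congr fun N => ?_
  congr 1
  ext n : 1
  have hpsi : P.psi (S ω) i j k (n + (k + 1)) = Sum.elim (selE p m q i *ᵥ (S ω).noise n)
      ((P.C j * selBlock κ p i) *ᵥ zeroState P.errA (fun t => P.noiseIn *ᵥ (S ω).noise t)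
        (n + (k + 1)) - selZ p m q j *ᵥ (S ω).noise (n + (k + 1)))
      + Sum.elim (0 : Fin (q i) → ℝ)
        ((P.C j * selBlock κ p i) *ᵥ (P.errA ^ (n + (k + 1)) *ᵥ P.Delta (S ω) 0)) := by
    rw [Plant.psi, if_pos (Nat.le_add_left _ _), Nat.add_sub_cancel, P.residual_eq (hv ω) (hν ω),
      eq_add_zeroState (P.Delta_succ (hv ω) (hν ω)), mulVec_add, Plant.selE_mulVec_noise]
    ext (a | a)
    · simp
    · simp only [Pi.add_apply, Pi.sub_apply, Sum.elim_inr]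
      ring
  rw [hpsi]

omit [MeasurableSpace Ω] in
theorem psi_inr_eq (hv : ∀ ω i n, (S ω).v i n = 0) (hν : ∀ ω i j n, (S ω).ν i j n = 0)
    (i j : Fin κ) (k n : ℕ) (ω : Ω) (b : Fin (m j)) :
    P.psi (S ω) i j k n (.inr b) = ∑ c, (P.C j * selBlock κ p i) b c * P.Delta (S ω) n c
      - (S ω).noise n (.inr (.inl ⟨j, b⟩)) := by
  rw [Plant.psi, Sum.elim_inr, P.residual_eq (hv ω) (hν ω), Pi.sub_apply, selZ,
    one_submatrix_mulVec]
  rfl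

theorem integrable_psi_and_tendsto (hS : NoiseModel P S μ) (hA : SchurStable P.errA)
    (hv : ∀ ω i n, (S ω).v i n = 0) (hν : ∀ ω i j n, (S ω).ν i j n = 0) (i j : Fin κ) (k : ℕ) :
    (∀ n, Integrable (fun ω => P.psi (S ω) i j k n) μ) ∧
      Tendsto (fun n => ∫ ω, P.psi (S ω) i j k n ∂μ) atTop (𝓝 0) := by
  have hw := hS.whiteNoise
  have hrec := fun n ω => P.Delta_succ (hv ω) (hν ω) n
  have hΔ := hw.integrable_of_recursion (X := fun n ω => P.Delta (S ω) n) hrec hS.integrable_Delta_zero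
  have hm := hw.integral_of_recursion (X := fun n ω => P.Delta (S ω) n) hrec hS.integrable_Delta_zero
  have hinl : ∀ n a, Integrable (fun ω => P.psi (S ω) i j k n (.inl a)) μ ∧
      ∫ ω, P.psi (S ω) i j k n (.inl a) ∂μ = 0 := fun n a => by
    simp only [Plant.psi, Sum.elim_inl]
    split_ifs with h
    · exact ⟨hw.integrable (n - (k + 1)) (.inr (.inr ⟨i, a⟩)),
        hw.mean (n - (k + 1)) (.inr (.inr ⟨i, a⟩))⟩
    · simp
  have hsum : ∀ n b, Integrable
      (fun ω => ∑ c, (P.C j * selBlock κ p i) b c * P.Delta (S ω) n c) μ := fun n b =>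
    integrable_finsetSum _ fun c _ => (hΔ n c).const_mul _
  have hinr : ∀ n b, Integrable (fun ω => P.psi (S ω) i j k n (.inr b)) μ := fun n b => by
    simp only [psi_inr_eq hv hν]
    exact (hsum n b).sub (hw.integrable n _)
  have hall : ∀ n c, Integrable (fun ω => P.psi (S ω) i j k n c) μ := by
    rintro n (a | b)
    · exact (hinl n a).1
    · exact hinr n b
  refine ⟨fun n => Integrable.of_eval (hall n), tendsto_pi_nhds.2 ?_⟩
  simp only [eval_integral (hall _)]
  rintro (a | b)
  · simp only [(hinl _ a).2]
    exact tendsto_const_nhds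
  -- The measurement noise has mean zero, so only the propagated mean of the initial error remains.
  · have e : ∀ n, ∫ ω, P.psi (S ω) i j k n (.inr b) ∂μ
        = ((P.C j * selBlock κ p i) *ᵥ (P.errA ^ n *ᵥ fun a => ∫ ω, P.Delta (S ω) 0 a ∂μ)) b :=
      fun n => by
        simp only [psi_inr_eq hv hν]
        rw [integral_sub (hsum n b) (hw.integrable n _), hw.mean, sub_zero,
          integral_finsetSum _ fun c _ => (hΔ n c).const_mul _, ← hm n]
        simp only [integral_const_mul]
        rfl
    simp only [e]
    have hc : Continuous fun x : Fin κ × Fin p → ℝ => (P.C j * selBlock κ p i) *ᵥ x := by fun_prop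
    exact tendsto_pi_nhds.1 ((hc.tendsto' 0 0 (mulVec_zero _)).comp (hA.tendsto_pow_mulVec _)) b

end NoiseModel

end Main

end NetLTI

/-! ### Assembly of the theorem. -/

theorem mainTheorem1 {κ p : ℕ} {m q : Fin κ → ℕ} {Ω : Type*} [MeasurableSpace Ω]
    (μ : Measure Ω) [IsProbabilityMeasure μ]
    (P : NetLTI.Plant κ p m q) (S : Ω → NetLTI.Signals κ p m q)
    (hS : NetLTI.NoiseModel P S μ)
    (hBK : NetLTI.SchurStable (P.A + P.BK))
    (hLC : NetLTI.SchurStable (P.A + P.LC))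
    (hBKLC : NetLTI.SchurStable (P.A + P.BK + P.LC))
    (hv : ∀ ω i n, (S ω).v i n = 0)
    (hν : ∀ ω i j n, (S ω).ν i j n = 0) :
    -- the cross-covariances of the observer errors with the past excitations
    (∀ (i : Fin κ) (k t : ℕ) (a : Fin κ × Fin p) (b : Fin (q i)),
      Integrable (fun ω => P.Delta (S ω) (t + k + 1) a * (S ω).e i t b) μ ∧
      ∫ ω, P.Delta (S ω) (t + k + 1) a * (S ω).e i t b ∂μ = P.crossCov i k a b) ∧
    -- the matrix `Σ_Δ` exists and is unique, and with it the limits hold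
    ∃ T : Matrix (Fin κ × Fin p) (Fin κ × Fin p) ℝ,
      P.IsErrLyapunov T ∧ (∀ T', P.IsErrLyapunov T' → T' = T) ∧
      ∀ (i j : Fin κ) (k' : ℕ),
        IsLeast {k : ℕ | P.C j * (P.A + P.BK) ^ k * P.B i ≠ 0} k' →
        (∀ᵐ ω ∂μ, Tendsto
          (fun N : ℕ => (N : ℝ)⁻¹ • ∑ n ∈ Finset.range N,
            Matrix.vecMulVec (P.psi (S ω) i j k' n) (P.psi (S ω) i j k' n))
          atTop (𝓝 (P.R T i j k'))) ∧
        (∀ n, Integrable (fun ω => P.psi (S ω) i j k' n) μ) ∧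
        Tendsto (fun n => ∫ ω, P.psi (S ω) i j k' n ∂μ) atTop (𝓝 0) := by
  have hA := P.errA_schurStable hLC hBKLC
  have hw := hS.whiteNoise
  refine ⟨fun i k t a b => ?_, ?_⟩
  · have h := hw.integral_mul_of_recursion (X := fun n ω => P.Delta (S ω) n)
      (fun n ω => P.Delta_succ (hv ω) (hν ω) n)
      (NetLTI.NoiseModel.measurable_Delta_zero P S) hS.integrable_Delta_zero t k a
      (.inr (.inr ⟨i, b⟩))
    refine ⟨h.1, h.2.trans ?_⟩
    rw [NetLTI.Plant.crossCov, ← P.noiseIn_mul_noiseCov_selE i,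
      NetLTI.Plant.selE, NetLTI.mul_one_submatrix_transpose]
    rfl
  · obtain ⟨T, hT⟩ := hA.exists_lyapunov_solution P.errCov
    have hpos : P.errCov.PosSemidef := by
      rw [P.errCov_eq]
      exact hw.posSemidef.mul_mul_conjTranspose_same P.noiseIn
    exact ⟨T, ⟨hA.posSemidef_lyapunov_solution hpos hT, hT⟩,
      fun T' hT' => hA.lyapunov_solution_unique hT hT'.2, fun i j k' _ =>
      ⟨hS.ae_tendsto_cesaro_psi hA hv hν hT i j k', hS.integrable_psi_and_tendsto hA hv hν i j k'⟩⟩
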